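/- Let $\beta>0$, $\gamma\ge 0$ be real, let $\Delta\ge 0$ be an integer and let $\lambda_0\in\mathbb R$. For a finite simple graph $G=(V,E)$, a set $S\subseteq V$ and a pinning $\tau_S\in\{0,1\}^S$, put $$Z^{\beta,\gamma}_{\tau_S}(G,\lambda)=\sum_{\substack{\sigma\in\{0,1\}^V\\ \sigma|_S=\tau_S}}\ \prod_{\{u,v\}\in E}A_{\sigma(u),\sigma(v)}\prod_{v\in V}b_{\sigma(v)},\qquad A_{0,0}=\beta,\ A_{1,1}=\gamma,\ A_{0,1}=A_{1,0}=1,\ b_0=1,\ b_1=\lambda .$$ The pinning $\tau_S$ is *feasible* if no edge inside $S$ has both ends pinned to $0$ in case $\beta=0$, and no edge inside $S$ has both ends pinned to $1$ in case $\gamma=0$. For real $d$ with $\sqrt{\beta\gamma}\le\frac{d-1}{d+1}$ put $$\hat x_d=\begin{cases}\dfrac{-1-\beta\gamma+d(1-\beta\gamma)-\sqrt{(-1-\beta\gamma+d(1-\beta\gamma))^2-4\beta\gamma}}{2\gamma},&\gamma>0,\\[2mm] \dfrac{\beta}{d-1},&\gamma=0,\end{cases}\qquad \lambda_c(d)=\hat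 x_d\left(\frac{\hat x_d+\beta}{\gamma\hat x_d+1}\right)^d ,$$ with $\lambda_c(1)=+\infty$ when $\gamma=0$. When $\beta>1$ and $\beta\gamma<1$, let $d_c>\bar d:=\frac{1+\sqrt{\beta\gamma}}{1-\sqrt{\beta\gamma}}$ be the point such that $\lambda_c$ is strictly decreasing on $(\bar d,d_c)$ and strictly increasing on $(d_c,\infty)$. For $\beta\gamma<1$ and $d>0$ put $$\check x_d=\frac{1-\beta\gamma+d(1+\beta\gamma)+\sqrt{(1-\beta\gamma+d(1+\beta\gamma))^2-4\beta\gamma d^2}}{2\beta d}.$$ Suppose that one of the following conditions holds. 1. $\beta\gamma>1$ and $0<\lambda_0<\left(\frac{\beta}{\gamma}\right)^{\frac{\sqrt{\beta\gamma}}{\sqrt{\beta\gamma}-1}}\max\{1,\gamma\}^{\frac{2\sqrt{\beta\gamma}}{\sqrt{\beta\gamma}-1}-\Delta}$. 2. $\beta\gamma>1$ and $-\max\{1,\gamma\}^{-\Delta}<\lambda_0<0$. 3. $\Delta\ge 2$, $\sqrt{\beta\gamma}\le\frac{\Delta-2}{\Delta}$, $\lambda_0>0$, and $\lambda_0<\lambda_c(d_c)$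 if $\beta>1$ and $\Delta>d_c+1$, while $\lambda_0<\lambda_c(\Delta-1)$ otherwise. 4. $\Delta\ge 2$, $\beta\gamma<1$, $\lambda_0<0$, and $\lambda_0>-\min\left\{1,\frac{\beta-1}{1-\gamma}\right\}$ if $\beta>1$ and $\Delta>\frac{1-\beta\gamma}{(\beta-1)(1-\gamma)}+1$, while $\lambda_0>-\frac{\beta\check x_d-1}{(\check x_d-\gamma)\,\check x_d^{\,d}}$ with $d=\Delta-1$ otherwise. Then there is $\delta>0$, depending only on $\Delta,\beta,\gamma,\lambda_0$, such that $Z^{\beta,\gamma}_{\tau_S}(G,\lambda)\ne 0$ for every finite simple graph $G$ of maximum degree at most $\Delta$, every feasible pinning $\tau_S$, and every complex $\lambda\ne 0$ at distance less than $\delta$ from the real segment between $0$ and $\lambda_0$. -/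

import Mathlib

namespace TwoSpin

/-- The edge interaction matrix `A` of a 2-spin system:
`A 0 0 = β`, `A 0 1 = A 1 0 = 1`, `A 1 1 = γ`. -/
def interaction (β γ : ℂ) : Matrix (Fin 2) (Fin 2) ℂ :=
  !![β, 1; 1, γ]

theorem interaction_symm (β γ : ℂ) (i j : Fin 2) :
    interaction β γ i j = interaction β γ j i := by
  fin_cases i <;> fin_cases j <;> rfl

/-- The vertex weights `b 0 = 1`, `b 1 = z` with activity `z`. -/
def activity (z : ℂ) : Fin 2 → ℂ :=
  ![1, z]

/-- The factor `A (σ u) (σ v)` that a configuration `σ` contributes on an edge `{u, v}`. -/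
def edgeWeight {V : Type*} (β γ : ℂ) (σ : V → Fin 2) : Sym2 V → ℂ :=
  Sym2.lift ⟨fun u v => interaction β γ (σ u) (σ v),
    fun u v => interaction_symm β γ (σ u) (σ v)⟩

/-- The partition function of the 2-spin system on the finite graph `G`, with the vertices in `S`
pinned to the spins prescribed by `τ`:
the sum over all configurations `σ` that extend `τ` of
`∏_{uv ∈ E} A (σ u) (σ v) * ∏_{v ∈ V} b (σ v)`. -/
def partitionFunction {V : Type*} [Fintype V] [DecidableEq V]
    (β γ : ℂ) (G : SimpleGraph V) [DecidableRel G.Adj]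
    (S : Finset V) (τ : S → Fin 2) (z : ℂ) : ℂ :=
  ∑ σ : V → Fin 2 with ∀ v : S, σ v = τ v,
    (∏ e ∈ G.edgeFinset, edgeWeight β γ σ e) * ∏ v, activity z (σ v)

/-- A pinning `τ` of `S` is feasible if no edge inside `S` has both ends pinned to `0` in case
`β = 0`, and no edge inside `S` has both ends pinned to `1` in case `γ = 0`. -/
def Feasible {V : Type*} (β γ : ℝ) (G : SimpleGraph V) (S : Finset V) (τ : S → Fin 2) : Prop :=
  (β = 0 → ∀ u v : S, G.Adj u v → ¬ (τ u = 0 ∧ τ v = 0)) ∧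
  (γ = 0 → ∀ u v : S, G.Adj u v → ¬ (τ u = 1 ∧ τ v = 1))

/-- The critical point `x̂_d`, for real `d` with `√(βγ) ≤ (d - 1) / (d + 1)`. -/
noncomputable def xHat (β γ d : ℝ) : ℝ :=
  if γ = 0 then β / (d - 1)
  else
    (-1 - β * γ + d * (1 - β * γ)
      - Real.sqrt ((-1 - β * γ + d * (1 - β * γ)) ^ 2 - 4 * (β * γ))) / (2 * γ)

/-- The uniqueness threshold `λ_c(d) = x̂_d ((x̂_d + β) / (γ x̂_d + 1)) ^ d`, for real `d`. -/
noncomputable def lambdaC (β γ d : ℝ) : ℝ :=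
  xHat β γ d * ((xHat β γ d + β) / (γ * xHat β γ d + 1)) ^ d

/-- `x < λ_c(d)`, where `λ_c(1) = +∞` for `γ = 0` (then `x̂_1 = β / 0 = +∞`). -/
def BelowLambdaC (β γ d x : ℝ) : Prop :=
  (γ = 0 ∧ d = 1) ∨ x < lambdaC β γ d

/-- The number `(1 + √(βγ)) / (1 - √(βγ))`, the left end of the range of `d`. -/
noncomputable def dBar (β γ : ℝ) : ℝ :=
  (1 + Real.sqrt (β * γ)) / (1 - Real.sqrt (β * γ))

/-- `dc` is the turning point of `λ_c`: the function `d ↦ λ_c(d)` is strictly decreasing on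
`(dBar, dc)` and strictly increasing on `(dc, ∞)`. There is at most one such point. -/
def IsTurningPoint (β γ dc : ℝ) : Prop :=
  dBar β γ < dc ∧
  StrictAntiOn (lambdaC β γ) (Set.Ioo (dBar β γ) dc) ∧
  StrictMonoOn (lambdaC β γ) (Set.Ioi dc)

/-- The turning point `d_c` of `λ_c` (used only for `β > 1`, `βγ < 1`). -/
noncomputable def dCrit (β γ : ℝ) : ℝ :=
  Classical.epsilon (IsTurningPoint β γ)

/-- The point `x̌_d`: the largest root of
`β d x² - (1 - βγ + d (1 + βγ)) x + γ d`. -/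
noncomputable def xCheck (β γ d : ℝ) : ℝ :=
  (1 - β * γ + d * (1 + β * γ)
    + Real.sqrt ((1 - β * γ + d * (1 + β * γ)) ^ 2 - 4 * (β * γ) * d ^ 2)) / (2 * β * d)

/-- Ferromagnetic, positive activities. -/
def FerroPos (β γ x₀ : ℝ) (Δ : ℕ) : Prop :=
  1 < β * γ ∧ 0 < x₀ ∧
  x₀ < (β / γ) ^ (Real.sqrt (β * γ) / (Real.sqrt (β * γ) - 1)) *
        max 1 γ ^ (2 * Real.sqrt (β * γ) / (Real.sqrt (β * γ) - 1) - (Δ : ℝ))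

/-- Ferromagnetic, negative activities. -/
def FerroNeg (β γ x₀ : ℝ) (Δ : ℕ) : Prop :=
  1 < β * γ ∧ x₀ < 0 ∧ -(max 1 γ ^ (-(Δ : ℝ))) < x₀

/-- Antiferromagnetic, positive activities. -/
def AntiferroPos (β γ x₀ : ℝ) (Δ : ℕ) : Prop :=
  2 ≤ Δ ∧ Real.sqrt (β * γ) ≤ ((Δ : ℝ) - 2) / Δ ∧ 0 < x₀ ∧
  ((1 < β ∧ dCrit β γ + 1 < Δ) → x₀ < lambdaC β γ (dCrit β γ)) ∧
  (¬ (1 < β ∧ dCrit β γ + 1 < Δ) → BelowLambdaC β γ ((Δ : ℝ) - 1) x₀)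

/-- Antiferromagnetic, negative activities. -/
def AntiferroNeg (β γ x₀ : ℝ) (Δ : ℕ) : Prop :=
  2 ≤ Δ ∧ β * γ < 1 ∧ x₀ < 0 ∧
  ((1 < β ∧ (1 - β * γ) / ((β - 1) * (1 - γ)) + 1 < Δ) →
    -(min 1 ((β - 1) / (1 - γ))) < x₀) ∧
  (¬ (1 < β ∧ (1 - β * γ) / ((β - 1) * (1 - γ)) + 1 < Δ) →
    -((β * xCheck β γ ((Δ : ℝ) - 1) - 1) /
      ((xCheck β γ ((Δ : ℝ) - 1) - γ) * xCheck β γ ((Δ : ℝ) - 1) ^ ((Δ : ℝ) - 1))) < x₀)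

end TwoSpin

namespace TwoSpin

/-! ### Deletion of a vertex in a weighted system -/

section Graph

variable {V : Type*} [DecidableEq V]

/-- The configuration with spin `1` exactly on `T`. -/
def spinOn (T : Finset V) (v : V) : Fin 2 := if v ∈ T then 1 else 0

/-- The weighted partition function of `G[A]`, in which the vertex `v` has weight `p v` at spin `0`
and weight `q v` at spin `1`. -/
noncomputable def weightSum [Fintype V] (β γ : ℂ) (G : SimpleGraph V) [DecidableRel G.Adj]
    (A : Finset V) (p q : V → ℂ) : ℂ :=
  ∑ T ∈ A.powerset, (∏ e ∈ G.edgeFinset with e ∈ A.sym2, edgeWeight β γ (spinOn T) e) *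
    ∏ v ∈ A, if v ∈ T then q v else p v

/-- Multiply `p` by `c` on `N`. -/
def scaleOn (c : ℂ) (N : Finset V) (p : V → ℂ) (v : V) : ℂ := if v ∈ N then c * p v else p v

theorem scaleOn_empty (c : ℂ) (p : V → ℂ) : scaleOn c ∅ p = p := by
  funext v; simp [scaleOn]

theorem scaleOn_one (N : Finset V) (p : V → ℂ) : scaleOn 1 N p = p := by
  funext v; simp [scaleOn]

theorem scaleOn_insert (c : ℂ) {u : V} {N : Finset V} (hu : u ∉ N) (p : V → ℂ) :
    scaleOn c (insert u N) p = scaleOn c N (scaleOn c {u} p) := by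
  funext v
  by_cases hv : v = u
  · subst hv; simp [scaleOn, hu]
  · simp [scaleOn, hv]

theorem scaleOn_insert' (c : ℂ) {u : V} {N : Finset V} (hu : u ∉ N) (p : V → ℂ) :
    scaleOn c (insert u N) p = scaleOn c {u} (scaleOn c N p) := by
  funext v
  by_cases hv : v = u
  · subst hv; simp [scaleOn, hu]
  · simp [scaleOn, hv]

variable [Fintype V] {β γ : ℂ} {G : SimpleGraph V} [DecidableRel G.Adj]

theorem weightSum_empty (p q : V → ℂ) : weightSum β γ G ∅ p q = 1 := by
  simp [weightSum]

theorem weightSum_congr {A : Finset V} {p q p' q' : V → ℂ} (hp : ∀ v ∈ A, p v = p' v)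
    (hq : ∀ v ∈ A, q v = q' v) : weightSum β γ G A p q = weightSum β γ G A p' q' := by
  unfold weightSum
  refine Finset.sum_congr rfl fun T _ => ?_
  congr 1
  exact Finset.prod_congr rfl fun v hv => by rw [hp v hv, hq v hv]

theorem prod_edges_insert {v : V} {A : Finset V} (hv : v ∉ A) (F : Sym2 V → ℂ) :
    ∏ e ∈ G.edgeFinset with e ∈ (insert v A).sym2, F e =
      (∏ u ∈ A with G.Adj v u, F s(v, u)) * ∏ e ∈ G.edgeFinset with e ∈ A.sym2, F e := by
  have hinj : Set.InjOn (fun u => s(v, u)) ((A.filter (G.Adj v) : Finset V) : Set V) := by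
    intro a _ b _ hab
    have : a = b ∨ v = b ∧ a = v := by simpa using hab
    rcases this with h | ⟨h1, h2⟩
    exacts [h, h2.trans h1]
  rw [← Finset.prod_image (s := A.filter (G.Adj v)) (g := fun u => s(v, u)) hinj,
    ← Finset.prod_union]
  · refine Finset.prod_congr ?_ fun _ _ => rfl
    ext e
    induction e using Sym2.ind with
    | _ x y =>
      simp only [Finset.mem_filter, SimpleGraph.mem_edgeFinset, SimpleGraph.mem_edgeSet,
        Finset.mk_mem_sym2_iff, Finset.mem_insert, Finset.mem_union, Finset.mem_image,
        Sym2.eq_iff]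
      constructor
      · rintro ⟨hxy, hx | hx, hy | hy⟩
        · exact absurd (hx.trans hy.symm) hxy.ne
        · left; exact ⟨y, ⟨hy, hx ▸ hxy⟩, Or.inl ⟨hx.symm, rfl⟩⟩
        · left; exact ⟨x, ⟨hx, hy ▸ hxy.symm⟩, Or.inr ⟨hy.symm, rfl⟩⟩
        · right; exact ⟨hxy, hx, hy⟩
      · rintro (⟨u, ⟨hu, huv⟩, ⟨rfl, rfl⟩ | ⟨rfl, rfl⟩⟩ | ⟨hxy, hx, hy⟩)
        · exact ⟨huv, Or.inl rfl, Or.inr hu⟩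
        · exact ⟨huv.symm, Or.inr hu, Or.inl rfl⟩
        · exact ⟨hxy, Or.inr hx, Or.inr hy⟩
  · rw [Finset.disjoint_left]
    rintro e he he'
    obtain ⟨u, _, rfl⟩ := Finset.mem_image.1 he
    simp only [Finset.mem_filter, Finset.mk_mem_sym2_iff] at he'
    exact hv he'.2.1

/-- Once the spin of `v` is fixed, an edge at `v` only rescales one weight at its other end, because
mixed edges have weight 1. Deletion therefore stays within the family of weighted sums. -/
theorem weightSum_insert {v : V} {A : Finset V} (hv : v ∉ A) (p q : V → ℂ) :
    weightSum β γ G (insert v A) p q =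
      p v * weightSum β γ G A (scaleOn β (A.filter (G.Adj v)) p) q +
      q v * weightSum β γ G A p (scaleOn γ (A.filter (G.Adj v)) q) := by
  unfold weightSum
  rw [Finset.sum_powerset_insert hv, Finset.mul_sum, Finset.mul_sum]
  congr 1
  · refine Finset.sum_congr rfl fun T hT => ?_
    have hT' : v ∉ T := fun h => hv (Finset.mem_powerset.1 hT h)
    rw [prod_edges_insert hv, Finset.prod_insert hv, if_neg hT', Finset.prod_filter]
    have : (∏ u ∈ A, if u ∈ T then q u else scaleOn β (A.filter (G.Adj v)) p u) =
        (∏ u ∈ A, if G.Adj v u then edgeWeight β γ (spinOn T) s(v, u) else 1) *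
          ∏ u ∈ A, if u ∈ T then q u else p u := by
      rw [← Finset.prod_mul_distrib]
      refine Finset.prod_congr rfl fun u hu => ?_
      by_cases h1 : u ∈ T <;> by_cases h2 : G.Adj v u <;>
        simp [edgeWeight, interaction, spinOn, scaleOn, h1, h2, hu, hT']
    rw [this]; ring
  · refine Finset.sum_congr rfl fun T hT => ?_
    have hT' : v ∉ T := fun h => hv (Finset.mem_powerset.1 hT h)
    rw [prod_edges_insert hv, Finset.prod_insert hv, if_pos (Finset.mem_insert_self _ _),
      Finset.prod_filter]
    have h1 : (∏ e ∈ G.edgeFinset with e ∈ A.sym2, edgeWeight β γ (spinOn (insert v T)) e) =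
        ∏ e ∈ G.edgeFinset with e ∈ A.sym2, edgeWeight β γ (spinOn T) e := by
      refine Finset.prod_congr rfl fun e he => ?_
      induction e using Sym2.ind with
      | _ x y =>
        simp only [Finset.mem_filter, Finset.mk_mem_sym2_iff] at he
        have hx : x ≠ v := fun h => hv (h ▸ he.2.1)
        have hy : y ≠ v := fun h => hv (h ▸ he.2.2)
        simp [edgeWeight, spinOn, hx, hy]
    have h2 : (∏ u ∈ A, if u ∈ T then scaleOn γ (A.filter (G.Adj v)) q u else p u) =
        (∏ u ∈ A, if G.Adj v u then edgeWeight β γ (spinOn (insert v T)) s(v, u) else 1) *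
          ∏ u ∈ A, if u ∈ insert v T then q u else p u := by
      rw [← Finset.prod_mul_distrib]
      refine Finset.prod_congr rfl fun u hu => ?_
      have huv : u ≠ v := fun h => hv (h ▸ hu)
      by_cases h1 : u ∈ T <;> by_cases h2 : G.Adj v u <;>
        simp [edgeWeight, interaction, spinOn, scaleOn, h1, h2, hu, huv]
    rw [h1, h2]; ring

theorem partitionFunction_eq_weightSum (S : Finset V) (τ : S → Fin 2) (z : ℂ) :
    partitionFunction β γ G S τ z = weightSum β γ G Finset.univ
      (fun v => if h : v ∈ S then (if τ ⟨v, h⟩ = 0 then 1 else 0) else 1)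
      (fun v => if h : v ∈ S then (if τ ⟨v, h⟩ = 0 then 0 else z) else z) := by
  unfold partitionFunction weightSum
  rw [Finset.sum_filter]
  refine Finset.sum_bij' (fun σ _ => Finset.univ.filter fun v => σ v = 1) (fun T _ => spinOn T)
    (fun _ _ => by simp) (fun _ _ => by simp) ?_ ?_ ?_
  · intro σ _
    funext v
    by_cases h : σ v = 1
    · simp [spinOn, h]
    · simp only [spinOn, Finset.mem_filter, Finset.mem_univ, true_and, h, if_false]
      omega
  · intro T _
    ext v
    by_cases h : v ∈ T <;> simp [spinOn, h]
  · intro σ _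
    have hσ : spinOn (Finset.univ.filter fun v => σ v = 1) = σ := by
      funext v
      by_cases h : σ v = 1
      · simp [spinOn, h]
      · simp only [spinOn, Finset.mem_filter, Finset.mem_univ, true_and, h, if_false]
        omega
    have hE : G.edgeFinset.filter (fun e => e ∈ (Finset.univ : Finset V).sym2) =
        G.edgeFinset := by
      simp
    rw [hσ, hE]
    split_ifs with hext
    · congr 1
      refine Finset.prod_congr rfl fun v _ => ?_
      have hcases : σ v = 0 ∨ σ v = 1 := by omega
      by_cases hS : v ∈ S
      · have := hext ⟨v, hS⟩
        simp only at this
        rcases hcases with h | h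
        · simp [activity, hS, ← this, h]
        · simp [activity, hS, ← this, h]
      · rcases hcases with h | h <;> simp [activity, hS, h]
    · push Not at hext
      obtain ⟨v, hv⟩ := hext
      symm
      apply mul_eq_zero_of_right
      apply Finset.prod_eq_zero (Finset.mem_univ v.1)
      have hcases : σ v = 0 ∨ σ v = 1 := by omega
      have hcases' : τ v = 0 ∨ τ v = 1 := by omega
      rcases hcases with h | h <;> rcases hcases' with h' | h' <;> simp_all

end Graph

/-! ### Zero-freeness from an invariant set of messages -/

/-- The set `U` of messages `(γ R + 1) / (R + β)` contains those of pinned vertices, is invariant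
under the recursion `R = z ∏ c` at vertices with at most `Δ - 1` children, and keeps the ratio `R`
of a vertex with at most `Δ` children away from `-1`. -/
structure MessageInvariant (β γ z : ℂ) (Δ : ℕ) (U : Set ℂ) : Prop where
  inv_mem : β⁻¹ ∈ U
  mem : γ ∈ U
  add_ne_zero : ∀ m : Multiset ℂ, (∀ c ∈ m, c ∈ U) → m.card + 1 ≤ Δ → z * m.prod + β ≠ 0
  step_mem : ∀ m : Multiset ℂ, (∀ c ∈ m, c ∈ U) → m.card + 1 ≤ Δ →
    (γ * (z * m.prod) + 1) / (z * m.prod + β) ∈ U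
  ne_neg_one : ∀ m : Multiset ℂ, (∀ c ∈ m, c ∈ U) → m.card ≤ Δ → z * m.prod ≠ -1

section Graph

variable {V : Type*} [DecidableEq V]

/-- The weights on `A` arise from activity `z` by pinning further neighbours, so that the degree in
`D` plus the number of these neighbours, plus one on `N`, is at most `Δ`. -/
def Admissible (β γ z : ℂ) (Δ : ℕ) (G : SimpleGraph V) [DecidableRel G.Adj]
    (D A N : Finset V) (p q : V → ℂ) : Prop :=
  ∀ v ∈ A, ∃ s t : ℕ, (D.filter (G.Adj v)).card + s + t + (if v ∈ N then 1 else 0) ≤ Δ ∧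
    p v = β ^ s ∧ q v = z * γ ^ t

variable {β γ z : ℂ} {Δ : ℕ} {G : SimpleGraph V} [DecidableRel G.Adj]
  {D A N M : Finset V} {p q : V → ℂ}

theorem Admissible.mono (h : Admissible β γ z Δ G D A N p q) {A' : Finset V} (hA : A' ⊆ A)
    (hM : M ⊆ N) : Admissible β γ z Δ G D A' M p q := by
  intro v hv
  obtain ⟨s, t, h1, h2, h3⟩ := h v (hA hv)
  refine ⟨s, t, ?_, h2, h3⟩
  by_cases hvM : v ∈ M
  · simpa [hvM, hM hvM] using h1
  · simp only [hvM, if_false]; omega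

theorem Admissible.scaleOn_left (h : Admissible β γ z Δ G D A N p q) {N' : Finset V}
    (hM : M ⊆ N) (hN' : N' ⊆ N) (hd : Disjoint M N') :
    Admissible β γ z Δ G D A M (scaleOn β N' p) q := by
  intro v hv
  obtain ⟨s, t, h1, h2, h3⟩ := h v hv
  by_cases hvN : v ∈ N'
  · have hvM : v ∉ M := fun h => Finset.disjoint_left.1 hd h hvN
    refine ⟨s + 1, t, ?_, ?_, h3⟩
    · simp only [hN' hvN, if_true] at h1
      simp only [hvM, if_false]; omega
    · simp [scaleOn, hvN, h2, pow_succ, mul_comm]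
  · refine ⟨s, t, ?_, by simp [scaleOn, hvN, h2], h3⟩
    by_cases hvM : v ∈ M
    · simpa [hvM, hM hvM] using h1
    · simp only [hvM, if_false]; omega

theorem Admissible.scaleOn_right (h : Admissible β γ z Δ G D A N p q) {N' : Finset V}
    (hM : M ⊆ N) (hN' : N' ⊆ N) (hd : Disjoint M N') :
    Admissible β γ z Δ G D A M p (scaleOn γ N' q) := by
  intro v hv
  obtain ⟨s, t, h1, h2, h3⟩ := h v hv
  by_cases hvN : v ∈ N'
  · have hvM : v ∉ M := fun h => Finset.disjoint_left.1 hd h hvN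
    refine ⟨s, t + 1, ?_, h2, ?_⟩
    · simp only [hN' hvN, if_true] at h1
      simp only [hvM, if_false]; omega
    · simp only [scaleOn, hvN, if_true, h3, pow_succ]; ring
  · refine ⟨s, t, ?_, h2, by simp [scaleOn, hvN, h3]⟩
    by_cases hvM : v ∈ M
    · simpa [hvM, hM hvM] using h1
    · simp only [hvM, if_false]; omega

/-- Deleting a vertex from the graph gains one unit of degree at its neighbours. -/
theorem Admissible.erase {u : V} (hu : u ∉ D) (h : Admissible β γ z Δ G (insert u D) A ∅ p q) :
    Admissible β γ z Δ G D A (A.filter (G.Adj u)) p q := by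
  intro v hv
  obtain ⟨s, t, h1, h2, h3⟩ := h v hv
  refine ⟨s, t, ?_, h2, h3⟩
  by_cases huv : G.Adj u v
  · have hvu : G.Adj v u := huv.symm
    rw [Finset.filter_insert, if_pos hvu, Finset.card_insert_of_notMem (by simp [hu])] at h1
    simp only [Finset.mem_filter, hv, huv, and_self, if_true]
    simp only [Finset.notMem_empty, if_false] at h1
    omega
  · have hvu : ¬ G.Adj v u := fun h => huv h.symm
    rw [Finset.filter_insert, if_neg hvu] at h1
    simpa [huv] using h1

variable [Fintype V]

/-- The two sums are what remains after deleting a vertex with neighbourhood `N` at spin 1 and at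
spin 0. Switching the vertices of `N` one by one costs one message each. At every stage the vertices
already switched and those still waiting carry factors `γ` and `β`, and this is why admissibility
must allow further pinned neighbours. -/
theorem weightSum_telescope {U : Set ℂ}
    (hmsg : ∀ p q : V → ℂ, ∀ u ∈ A, Admissible β γ z Δ G A A {u} p q →
      ∃ c ∈ U, weightSum β γ G A p (scaleOn γ {u} q) =
        c * weightSum β γ G A (scaleOn β {u} p) q) (hN : N ⊆ A) :
    ∀ p q : V → ℂ, Admissible β γ z Δ G A A N p q →
      ∃ m : Multiset ℂ, m.card = N.card ∧ (∀ c ∈ m, c ∈ U) ∧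
        weightSum β γ G A p (scaleOn γ N q) =
          m.prod * weightSum β γ G A (scaleOn β N p) q := by
  induction N using Finset.induction_on with
  | empty => intro p q _; exact ⟨0, by simp [scaleOn_empty]⟩
  | insert u N hu ih =>
    intro p q hpq
    have huN : Disjoint N {u} := by simpa using hu
    have hsub : ({u} : Finset V) ⊆ insert u N := by simp
    obtain ⟨m, hm1, hm2, hm3⟩ := ih (fun v hv => hN (Finset.mem_insert_of_mem hv)) p
      (scaleOn γ {u} q) (hpq.scaleOn_right (Finset.subset_insert _ _) hsub huN)
    obtain ⟨c, hc, hc'⟩ := hmsg (scaleOn β N p) q u (hN (Finset.mem_insert_self _ _))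
      (hpq.scaleOn_left hsub (Finset.subset_insert _ _) huN.symm)
    refine ⟨c ::ₘ m, by simp [hm1, hu], ?_, ?_⟩
    · intro a ha
      rcases Multiset.mem_cons.1 ha with rfl | ha
      exacts [hc, hm2 a ha]
    · rw [scaleOn_insert γ hu, hm3, hc', scaleOn_insert' β hu, Multiset.prod_cons]; ring

/-- Nonvanishing and control of messages support each other: both follow for `A` by deleting one
vertex, where messages of the smaller set give the ratio and its nonvanishing lets one factor out
the spin-0 part. -/
theorem weightSum_ne_zero_and_message {U : Set ℂ} (hU : MessageInvariant β γ z Δ U)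
    (hβ : β ≠ 0) (A : Finset V) :
    (∀ p q : V → ℂ, Admissible β γ z Δ G A A ∅ p q → weightSum β γ G A p q ≠ 0) ∧
    ∀ p q : V → ℂ, ∀ u ∈ A, Admissible β γ z Δ G A A {u} p q →
      ∃ c ∈ U, weightSum β γ G A p (scaleOn γ {u} q) =
        c * weightSum β γ G A (scaleOn β {u} p) q := by
  induction A using Finset.strongInduction with
  | H A IH =>
  -- Here `z * m.prod` is the ratio at `u` and `p u * W` is the spin-0 part. With `k = 0` and `a = b
  -- = 1` this gives nonvanishing. With `k = 1` the pairs `(1, γ)` and `(β, 1)` give numerator and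
  -- denominator of the message; the reserved unit of degree belongs to the receiver and leaves at
  -- most `Δ - 1` factors.
  have key : ∀ p q : V → ℂ, ∀ u ∈ A, ∀ k : ℕ, Admissible β γ z Δ G A A ∅ p q →
      (∃ s t : ℕ, (A.filter (G.Adj u)).card + s + t + k ≤ Δ ∧ p u = β ^ s ∧ q u = z * γ ^ t) →
      ∃ W : ℂ, W ≠ 0 ∧ ∃ m : Multiset ℂ, (∀ c ∈ m, c ∈ U) ∧ m.card + k ≤ Δ ∧ p u ≠ 0 ∧
        ∀ a b : ℂ, weightSum β γ G A (scaleOn a {u} p) (scaleOn b {u} q) =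
          (a + b * (z * m.prod)) * p u * W := by
    intro p q u hu k hpq ⟨s, t, hst, hp, hq⟩
    obtain ⟨A', hA', rfl⟩ : ∃ A', u ∉ A' ∧ A = insert u A' :=
      ⟨A.erase u, by simp, (Finset.insert_erase hu).symm⟩
    obtain ⟨ih1, ih2⟩ := IH A' (Finset.ssubset_insert hA')
    have hadm : Admissible β γ z Δ G A' A' (A'.filter (G.Adj u)) p q :=
      (hpq.mono (Finset.subset_insert _ _) subset_rfl).erase hA'
    obtain ⟨m, hm1, hm2, hm3⟩ := weightSum_telescope ih2 (Finset.filter_subset _ _) p q hadm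
    refine ⟨weightSum β γ G A' (scaleOn β (A'.filter (G.Adj u)) p) q,
      ih1 _ _ (hadm.scaleOn_left (Finset.empty_subset _) subset_rfl (by simp)),
      -- The weight `β ^ s` at spin 0 is divided out, so a neighbour pinned to 0 acts as the message
      -- `β⁻¹`.
      m + (Multiset.replicate s β⁻¹ + Multiset.replicate t γ), ?_, ?_, ?_, ?_⟩
    · intro c hc
      rcases Multiset.mem_add.1 hc with hc | hc
      · exact hm2 c hc
      rcases Multiset.mem_add.1 hc with hc | hc
      · rw [Multiset.eq_of_mem_replicate hc]; exact hU.inv_mem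
      · rw [Multiset.eq_of_mem_replicate hc]; exact hU.mem
    · rw [Finset.filter_insert, if_neg (G.loopless.irrefl u)] at hst
      simp only [Multiset.card_add, Multiset.card_replicate, hm1]
      omega
    · rw [hp]; exact pow_ne_zero _ hβ
    · intro a b
      have hne : ∀ v ∈ A', v ≠ u := fun v hv h => hA' (h ▸ hv)
      rw [weightSum_insert hA',
        weightSum_congr (p' := scaleOn β (A'.filter (G.Adj u)) p) (q' := q)
          (fun v hv => by simp [scaleOn, hne v hv]) (fun v hv => by simp [scaleOn, hne v hv]),
        weightSum_congr (p := scaleOn a {u} p) (p' := p)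
          (q' := scaleOn γ (A'.filter (G.Adj u)) q)
          (fun v hv => by simp [scaleOn, hne v hv]) (fun v hv => by simp [scaleOn, hne v hv]),
        hm3]
      simp only [scaleOn, Finset.mem_singleton, if_true, Multiset.prod_add,
        Multiset.prod_replicate, hp, hq, inv_pow]
      field_simp
  constructor
  · intro p q hpq
    rcases A.eq_empty_or_nonempty with rfl | ⟨u, hu⟩
    · simp [weightSum_empty]
    obtain ⟨s, t, h1, h2⟩ := hpq u hu
    obtain ⟨W, hW, m, hm1, hm2, hpu, hm3⟩ := key p q u hu 0 hpq ⟨s, t, by simpa using h1, h2⟩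
    have := hm3 1 1
    rw [scaleOn_one, scaleOn_one, one_mul] at this
    rw [this]
    refine mul_ne_zero (mul_ne_zero ?_ hpu) hW
    intro h
    exact hU.ne_neg_one m hm1 (by omega) (by linear_combination h)
  · intro p q u hu hpq
    obtain ⟨s, t, h1, h2⟩ := hpq u hu
    obtain ⟨W, hW, m, hm1, hm2, hpu, hm3⟩ :=
      key p q u hu 1 (hpq.mono subset_rfl (Finset.empty_subset _)) ⟨s, t, by simpa using h1, h2⟩
    have e1 := hm3 1 γ
    have e2 := hm3 β 1
    rw [scaleOn_one] at e1 e2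
    refine ⟨_, hU.step_mem m hm1 hm2, ?_⟩
    have := hU.add_ne_zero m hm1 hm2
    rw [e1, e2]
    field_simp
    ring

/-- At a pinned vertex only one term of the deletion formula survives, so pinned vertices are
removed one at a time. Each removal turns a unit of degree of an unpinned neighbour into a factor
`β` or `γ`. Feasibility keeps the weight of a vertex pinned to 1 from becoming 0 when `γ = 0`. -/
theorem weightSum_ne_zero_of_pinned {U : Set ℂ} (hU : MessageInvariant β γ z Δ U)
    (hβ : β ≠ 0) (A B : Finset V) (hAB : Disjoint A B) :
    ∀ p q : V → ℂ, (∀ v ∈ B, (p v ≠ 0 ∧ q v = 0) ∨ (p v = 0 ∧ q v ≠ 0)) →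
      (∀ u ∈ B, ∀ v ∈ B, G.Adj u v → q u ≠ 0 → q v ≠ 0 → γ ≠ 0) →
      Admissible β γ z Δ G (B ∪ A) A ∅ p q → weightSum β γ G (B ∪ A) p q ≠ 0 := by
  induction B using Finset.induction_on with
  | empty =>
    intro p q _ _ h
    rw [Finset.empty_union] at h ⊢
    exact (weightSum_ne_zero_and_message hU hβ A).1 p q h
  | insert u B hu ih =>
    intro p q hpin hfeas h
    have huA : u ∉ A := fun h => Finset.disjoint_left.1 hAB h (Finset.mem_insert_self _ _)
    have hAB' : Disjoint A B := hAB.mono_right (Finset.subset_insert _ _)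
    have huBA : u ∉ B ∪ A := by simp [hu, huA]
    rw [Finset.insert_union] at h ⊢
    have h' := h.erase huBA
    have hext : ∀ {c : ℂ} {r : V → ℂ}, ∀ v ∈ A,
        scaleOn c ((B ∪ A).filter (G.Adj u)) r v = scaleOn c (A.filter (G.Adj u)) r v := by
      intro c r v hv
      simp [scaleOn, hv]
    rw [weightSum_insert huBA]
    rcases hpin u (Finset.mem_insert_self _ _) with ⟨hp, hq⟩ | ⟨hp, hq⟩
    · rw [hq, zero_mul, add_zero]
      refine mul_ne_zero hp (ih hAB' _ _ ?_ ?_ ?_)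
      · intro v hv
        rcases hpin v (Finset.mem_insert_of_mem hv) with ⟨h1, h2⟩ | ⟨h1, h2⟩
        · left; refine ⟨?_, h2⟩
          unfold scaleOn; split_ifs
          exacts [mul_ne_zero hβ h1, h1]
        · right; refine ⟨?_, h2⟩
          simp [scaleOn, h1]
      · intro v hv w hw
        exact hfeas v (Finset.mem_insert_of_mem hv) w (Finset.mem_insert_of_mem hw)
      · intro v hv
        rw [hext v hv]
        exact h'.scaleOn_left (Finset.empty_subset _) subset_rfl (by simp) v hv
    · rw [hp, zero_mul, zero_add]
      refine mul_ne_zero hq (ih hAB' _ _ ?_ ?_ ?_)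
      · intro v hv
        rcases hpin v (Finset.mem_insert_of_mem hv) with ⟨h1, h2⟩ | ⟨h1, h2⟩
        · left; refine ⟨h1, ?_⟩
          simp [scaleOn, h2]
        · right; refine ⟨h1, ?_⟩
          unfold scaleOn; split_ifs with hmem
          · exact mul_ne_zero (hfeas u (Finset.mem_insert_self _ _) v
              (Finset.mem_insert_of_mem hv) (Finset.mem_filter.1 hmem).2 hq h2) h2
          · exact h2
      · intro v hv w hw hvw h1 h2
        refine hfeas v (Finset.mem_insert_of_mem hv) w (Finset.mem_insert_of_mem hw) hvw ?_ ?_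
        · intro h0; simp [scaleOn, h0] at h1
        · intro h0; simp [scaleOn, h0] at h2
      · intro v hv
        rw [hext v hv]
        exact h'.scaleOn_right (Finset.empty_subset _) subset_rfl (by simp) v hv

end Graph

theorem MessageInvariant.partitionFunction_ne_zero {V : Type*} [Fintype V] [DecidableEq V]
    {β γ : ℝ} (hβ : β ≠ 0) {z : ℂ} (hz : z ≠ 0) {Δ : ℕ} {U : Set ℂ}
    (hU : MessageInvariant β γ z Δ U) {G : SimpleGraph V} [DecidableRel G.Adj]
    (hG : ∀ v, G.degree v ≤ Δ) {S : Finset V} {τ : S → Fin 2} (hτ : Feasible β γ G S τ) :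
    partitionFunction β γ G S τ z ≠ 0 := by
  rw [partitionFunction_eq_weightSum, ← Finset.union_compl S]
  refine weightSum_ne_zero_of_pinned hU (by exact_mod_cast hβ) Sᶜ S disjoint_compl_left _ _
    ?_ ?_ ?_
  · intro v hv
    simp only [hv, dif_pos]
    by_cases h : τ ⟨v, hv⟩ = 0 <;> simp [h, hz]
  · intro u hu v hv huv h1 h2 h0
    simp only [hu, hv, dif_pos] at h1 h2
    have hu1 : τ ⟨u, hu⟩ = 1 := by
      by_contra h; exact h1 (by rw [if_pos (by omega)])
    have hv1 : τ ⟨v, hv⟩ = 1 := by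
      by_contra h; exact h2 (by rw [if_pos (by omega)])
    exact hτ.2 (by exact_mod_cast h0) ⟨u, hu⟩ ⟨v, hv⟩ huv ⟨hu1, hv1⟩
  · intro v hv
    have hv' : v ∉ S := by simpa using hv
    refine ⟨0, 0, ?_, by simp [hv'], by simp [hv']⟩
    have : Finset.univ.filter (G.Adj v) = G.neighborFinset v := by
      ext w; simp
    simp only [Finset.union_compl, this, Finset.notMem_empty, if_false, add_zero]
    exact hG v

/-! ### Invariant discs, for negative activities -/

theorem norm_multiset_prod_le {M : ℝ} {m : Multiset ℂ} (hm : ∀ c ∈ m, ‖c‖ ≤ M) :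
    ‖m.prod‖ ≤ M ^ m.card := by
  induction m using Multiset.induction_on with
  | empty => simp
  | cons a m ih =>
    rw [Multiset.prod_cons, norm_mul, Multiset.card_cons, pow_succ']
    have ha := hm a (Multiset.mem_cons_self _ _)
    exact mul_le_mul ha (ih fun c hc => hm c (Multiset.mem_cons_of_mem hc)) (norm_nonneg _)
      ((norm_nonneg _).trans ha)

/-- Invariance of the disc of radius `M`. -/
theorem messageInvariant_closedBall {β γ M : ℝ} {z : ℂ} {Δ : ℕ} (hβ : 0 < β) (hγ : 0 ≤ γ)
    (hM : 1 ≤ M) (hβM : β⁻¹ ≤ M) (hγM : γ ≤ M) (hroot : ‖z‖ * M ^ Δ < 1)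
    (hstep : ∀ R : ℂ, 1 ≤ Δ → ‖R‖ ≤ ‖z‖ * M ^ (Δ - 1) → R + β ≠ 0 ∧ ‖γ * R + 1‖ ≤ M * ‖R + β‖) :
    MessageInvariant β γ z Δ (Metric.closedBall 0 M) := by
  have hle : ∀ m : Multiset ℂ, (∀ c ∈ m, c ∈ Metric.closedBall (0 : ℂ) M) → ∀ n, m.card ≤ n →
      ‖z * m.prod‖ ≤ ‖z‖ * M ^ n := by
    intro m hm n hn
    rw [norm_mul]
    refine mul_le_mul_of_nonneg_left ?_ (norm_nonneg _)
    exact (norm_multiset_prod_le fun c hc => by simpa using hm c hc).trans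
      (pow_le_pow_right₀ hM hn)
  refine ⟨?_, ?_, ?_, ?_, ?_⟩
  · simpa [abs_of_pos hβ] using hβM
  · simpa [abs_of_nonneg hγ] using hγM
  · intro m hm hc
    exact (hstep _ (by omega) (hle m hm _ (by omega))).1
  · intro m hm hc
    obtain ⟨h1, h2⟩ := hstep _ (by omega) (hle m hm (Δ - 1) (by omega))
    rw [mem_closedBall_zero_iff, norm_div, div_le_iff₀ (norm_pos_iff.2 h1)]
    exact h2
  · intro m hm hc h
    have := hle m hm Δ hc
    rw [h, norm_neg, norm_one] at this
    linarith

/-- The condition `‖z‖ * M ^ Δ < 1`, which excludes the ratio `-1`, already forces `‖R‖ * M < 1`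
with one factor fewer, and that makes the disc invariant. -/
theorem messageInvariant_of_ferroNeg {β γ : ℝ} {z : ℂ} {Δ : ℕ} (hβ : 0 < β) (hγ : 0 ≤ γ)
    (hβγ : 1 < β * γ) (hz : ‖z‖ < max 1 γ ^ (-(Δ : ℝ))) :
    MessageInvariant β γ z Δ (Metric.closedBall 0 (max 1 γ)) := by
  set M := max 1 γ with hMdef
  have hM : 1 ≤ M := le_max_left _ _
  have hγM : γ ≤ M := le_max_right _ _
  have hM0 : 0 < M := by linarith
  have hroot : ‖z‖ * M ^ Δ < 1 := by
    rw [Real.rpow_neg hM0.le, Real.rpow_natCast] at hz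
    have := mul_lt_mul_of_pos_right hz (pow_pos hM0 Δ)
    rwa [inv_mul_cancel₀ (pow_pos hM0 Δ).ne'] at this
  have hγ0 : 0 < γ := hγ.lt_of_ne (by rintro rfl; simp at hβγ; linarith)
  have hβM : 1 < β * M := hβγ.trans_le (mul_le_mul_of_nonneg_left hγM hβ.le)
  refine messageInvariant_closedBall hβ hγ hM ?_ hγM hroot ?_
  · rw [inv_le_iff_one_le_mul₀' hβ]; exact hβM.le
  · intro R hΔ hR
    have hRM : ‖R‖ * M < 1 := by
      refine lt_of_le_of_lt ?_ hroot
      calc ‖R‖ * M ≤ ‖z‖ * M ^ (Δ - 1) * M := mul_le_mul_of_nonneg_right hR hM0.le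
        _ = ‖z‖ * M ^ Δ := by rw [mul_assoc, ← pow_succ, Nat.sub_add_cancel hΔ]
    have hRβ : ‖R‖ < β := by
      have : ‖R‖ * M < β * M := hRM.trans hβM
      exact lt_of_mul_lt_mul_right this hM0.le
    have hne : R + β ≠ 0 := by
      intro h
      have : R = -β := by linear_combination h
      rw [this, norm_neg, Complex.norm_real, Real.norm_of_nonneg hβ.le] at hRβ
      exact lt_irrefl _ hRβ
    refine ⟨hne, ?_⟩
    have hre : -‖R‖ ≤ R.re := (abs_le.1 (Complex.abs_re_le_norm R)).1
    have hsq : ‖R‖ ^ 2 = R.re ^ 2 + R.im ^ 2 := by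
      rw [← Complex.normSq_eq_norm_sq, Complex.normSq_apply]; ring
    refine le_of_sq_le_sq ?_ (by positivity)
    have e1 : ‖(γ : ℂ) * R + 1‖ ^ 2 = γ ^ 2 * ‖R‖ ^ 2 + 2 * γ * R.re + 1 := by
      rw [hsq, ← Complex.normSq_eq_norm_sq, Complex.normSq_apply]
      simp; ring
    have e2 : ‖R + (β : ℂ)‖ ^ 2 = ‖R‖ ^ 2 + 2 * β * R.re + β ^ 2 := by
      rw [hsq, ← Complex.normSq_eq_norm_sq, Complex.normSq_apply]
      simp; ring
    rw [mul_pow, e1, e2]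
    have hR0 := norm_nonneg R
    -- For `γ ≤ 1` the worst `R` is negative real, since `β > γ`. For `γ ≥ 1` the terms in `‖R‖ ^ 2`
    -- cancel and the difference of squares factors.
    rcases le_total γ 1 with h | h
    · have hM1 : M = 1 := max_eq_left h
      rw [hM1] at hRM hβM ⊢
      have : 2 < β + γ := by nlinarith [sq_nonneg (β - γ)]
      have h3 : (1 - γ * ‖R‖) ^ 2 ≤ (β - ‖R‖) ^ 2 := by
        apply pow_le_pow_left₀ <;> nlinarith
      nlinarith
    · have hM1 : M = γ := max_eq_right h
      rw [hM1] at hRM hβM ⊢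
      have h3 : 0 ≤ (γ * β - 1) * (γ * β + 1 + 2 * γ * R.re) := by
        apply mul_nonneg <;> nlinarith
      nlinarith

/-- The message is `γ + (1 - β γ) / (R + β)`, which is largest in modulus at `R = -‖R‖`; the
hypothesis on `‖z‖` says that it stays below `M` there. -/
theorem messageInvariant_of_antiferro {β γ M : ℝ} {z : ℂ} {Δ : ℕ} (hβ : 0 < β) (hγ : 0 ≤ γ)
    (hβγ : β * γ < 1) (hM : 1 ≤ M) (hβM : β⁻¹ ≤ M)
    (hz : ‖z‖ * M ^ (Δ - 1) * (M - γ) < β * M - 1) (hroot : ‖z‖ * M ^ Δ < 1) :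
    MessageInvariant β γ z Δ (Metric.closedBall 0 M) := by
  have hγM : γ < M := by
    rw [inv_le_iff_one_le_mul₀' hβ] at hβM
    by_contra! h
    have := mul_le_mul_of_nonneg_left h hβ.le
    linarith
  refine messageInvariant_closedBall hβ hγ hM hβM hγM.le hroot ?_
  intro R hΔ hR
  have hRM : ‖R‖ * (M - γ) < β * M - 1 :=
    (mul_le_mul_of_nonneg_right hR (by linarith)).trans_lt hz
  have hRβ : ‖R‖ < β := by
    by_contra! h
    have := mul_le_mul_of_nonneg_right h (sub_nonneg.2 hγM.le)
    nlinarith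
  have hlow : β - ‖R‖ ≤ ‖R + β‖ := by
    have := norm_sub_norm_le (β : ℂ) (-R)
    rw [Complex.norm_real, Real.norm_of_nonneg hβ.le, norm_neg, sub_neg_eq_add, add_comm] at this
    rwa [add_comm] at this ⊢
  have hne : R + β ≠ 0 := by
    intro h
    rw [h, norm_zero] at hlow
    linarith
  refine ⟨hne, ?_⟩
  have e : (γ : ℂ) * R + 1 = γ * (R + β) + ((1 - β * γ : ℝ) : ℂ) := by push_cast; ring
  rw [e]
  refine (norm_add_le _ _).trans ?_
  rw [norm_mul, Complex.norm_real, Complex.norm_real, Real.norm_of_nonneg hγ,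
    Real.norm_of_nonneg (by linarith)]
  have := mul_le_mul_of_nonneg_right hlow (sub_nonneg.2 hγM.le)
  nlinarith

/-- The admissible `‖z‖` for radius `M` is `(β M - 1) / ((M - γ) M ^ (Δ - 1))`. Its critical point
in `M` is `xCheck`; the first case is the one where this point lies below 1, and there `M = 1` is
taken. -/
theorem exists_messageInvariant_of_antiferroNeg {β γ x₀ : ℝ} {Δ : ℕ} (hβ : 0 < β) (hγ : 0 ≤ γ)
    (h : AntiferroNeg β γ x₀ Δ) :
    ∃ ρ, |x₀| < ρ ∧ ∀ z : ℂ, ‖z‖ < ρ → ∃ U, MessageInvariant β γ z Δ U := by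
  obtain ⟨hΔ, hβγ, hx, h1, h2⟩ := h
  rw [abs_of_neg hx]
  by_cases hc : 1 < β ∧ (1 - β * γ) / ((β - 1) * (1 - γ)) + 1 < Δ
  · have hγ1 : γ < 1 := by nlinarith [hc.1]
    refine ⟨_, neg_lt.1 (h1 hc), fun z hz => ⟨_, messageInvariant_of_antiferro hβ hγ hβγ
      le_rfl (inv_le_one_of_one_le₀ hc.1.le) ?_ ?_⟩⟩
    · have := hz.trans_le (min_le_right _ _)
      rw [lt_div_iff₀ (by linarith)] at this
      simpa using this
    · simpa using hz.trans_le (min_le_left _ _)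
  · have hx' := h2 hc
    obtain ⟨n, rfl⟩ : ∃ n, Δ = n + 1 := ⟨Δ - 1, by omega⟩
    have hn1 : (1 : ℝ) ≤ n := by exact_mod_cast (by omega : 1 ≤ n)
    have hcast : (((n + 1 : ℕ) : ℝ) - 1) = n := by push_cast; ring
    rw [hcast] at hx'
    set X := xCheck β γ n with hX
    set b := 1 - β * γ + n * (1 + β * γ) with hb
    have hβγ0 : 0 ≤ β * γ := mul_nonneg hβ.le hγ
    have hb0 : 0 < b := by nlinarith
    have hdisc : 0 ≤ b ^ 2 - 4 * (β * γ) * (n : ℝ) ^ 2 := by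
      have h1 : (n : ℝ) * (1 + β * γ) ≤ b := by linarith
      have h2 : ((n : ℝ) * (1 + β * γ)) ^ 2 ≤ b ^ 2 := pow_le_pow_left₀ (by positivity) h1 2
      nlinarith [mul_nonneg (sq_nonneg (n : ℝ)) (sq_nonneg (1 - β * γ))]
    have hsq := Real.sq_sqrt hdisc
    have hXe : 2 * β * n * X = b + Real.sqrt (b ^ 2 - 4 * (β * γ) * (n : ℝ) ^ 2) := by
      rw [hX, xCheck, ← hb]
      field_simp
    have hs0 := Real.sqrt_nonneg (b ^ 2 - 4 * (β * γ) * (n : ℝ) ^ 2)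
    set r := Real.sqrt (b ^ 2 - 4 * (β * γ) * (n : ℝ) ^ 2) with hr
    -- a number at which the quadratic is nonpositive is at most `X`
    have hle : ∀ y : ℝ, β * n * y ^ 2 - b * y + γ * n ≤ 0 → y ≤ X := by
      intro y hy
      have hβn : 0 < 2 * β * n := by positivity
      have h3 : (2 * β * n * y - b) ^ 2 ≤ r ^ 2 := by
        rw [hsq]; nlinarith
      have h4 : 2 * β * n * y - b ≤ r := abs_le_of_sq_le_sq' h3 hs0 |>.2
      have : 2 * β * n * y ≤ 2 * β * n * X := by linarith
      exact le_of_mul_le_mul_left this hβn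
    have hroot : β * n * X ^ 2 - b * X + γ * n = 0 := by
      have h3 : (2 * β * n * X - b) ^ 2 = r ^ 2 := by rw [hXe]; ring
      rw [hsq] at h3
      have h4 : 4 * β * n * (β * n * X ^ 2 - b * X + γ * n) = 0 := by linear_combination h3
      have : 4 * β * n ≠ 0 := by positivity
      exact (mul_eq_zero.1 h4).resolve_left this
    have hβX : β⁻¹ ≤ X := by
      apply hle
      have : β * n * β⁻¹ ^ 2 - b * β⁻¹ + γ * n = -(1 - β * γ) * β⁻¹ := by
        rw [hb]; field_simp; ring
      rw [this]
      have : 0 < β⁻¹ := by positivity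
      nlinarith
    have hX1 : 1 ≤ X := by
      by_cases hβ1 : 1 < β
      · have hγ1 : γ < 1 := by nlinarith
        have h3 : ¬ ((1 - β * γ) / ((β - 1) * (1 - γ)) + 1 < ((n + 1 : ℕ) : ℝ)) :=
          fun h => hc ⟨hβ1, h⟩
        have h4 : (n : ℝ) ≤ (1 - β * γ) / ((β - 1) * (1 - γ)) := by
          push_cast at h3; linarith
        rw [le_div_iff₀ (mul_pos (by linarith) (by linarith))] at h4
        apply hle
        rw [hb]; nlinarith
      · exact (one_le_inv_iff₀.2 ⟨hβ, not_lt.1 hβ1⟩).trans hβX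
    have hX0 : 0 < X := by linarith
    have hβX1 : 1 ≤ β * X := by
      rwa [inv_le_iff_one_le_mul₀' hβ] at hβX
    have hγX : γ < X := by
      by_contra! h
      have := mul_le_mul_of_nonneg_left h hβ.le
      linarith
    -- At the radius `X` the invariance bound thus implies the root condition `‖z‖ * X ^ Δ < 1`.
    have hfin : X * (β * X - 1) ≤ X - γ := by
      have h5 : n * (X * (β * X - 1) - (X - γ)) = - ((n - 1) * (1 - β * γ) * X) := by
        rw [hb] at hroot
        linear_combination hroot
      have h6 : 0 ≤ (n - 1) * (1 - β * γ) * X :=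
        mul_nonneg (mul_nonneg (by linarith) (by linarith)) hX0.le
      by_contra! h
      have : 0 < n * (X * (β * X - 1) - (X - γ)) := mul_pos (by linarith) (by linarith)
      linarith
    rw [Real.rpow_natCast] at hx'
    refine ⟨_, neg_lt.1 hx', fun z hz => ⟨_, messageInvariant_of_antiferro hβ hγ hβγ
      hX1 hβX ?_ ?_⟩⟩
    all_goals
      rw [lt_div_iff₀ (mul_pos (by linarith) (pow_pos hX0 _))] at hz
    · simp only [Nat.add_sub_cancel]; linarith
    · have h7 := mul_lt_mul_of_pos_right hz hX0
      have h8 : (‖z‖ * X ^ (n + 1)) * (X - γ) < 1 * (X - γ) := by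
        calc (‖z‖ * X ^ (n + 1)) * (X - γ) = ‖z‖ * ((X - γ) * X ^ n) * X := by ring
          _ < (β * X - 1) * X := h7
          _ ≤ _ := by linarith
      exact lt_of_mul_lt_mul_right h8 (by linarith)

/-! ### From real contraction to complex invariance -/

/-- The logarithm of the message sent by a vertex with ratio `f`. -/
noncomputable def logMessage (β γ f : ℝ) : ℝ := Real.log ((γ * f + 1) / (f + β))

/-- The absolute value of the derivative of `logMessage` with respect to `log f`. -/
noncomputable def messageSlope (β γ f : ℝ) : ℝ := |β * γ - 1| * f / ((γ * f + 1) * (f + β))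

/-- On the set `I` of logarithmic messages, the tree recursion with activity `x ≥ 0` is a
contraction, in the metric with density `1 / w`. -/
structure RealContraction (β γ x : ℝ) (Δ : ℕ) (I : Set ℝ) (w : ℝ → ℝ) (η w₀ w₁ L : ℝ) : Prop where
  abs_le : ∀ y ∈ I, |y| ≤ L
  weight_ge : ∀ y ∈ I, w₀ ≤ w y
  weight_le : ∀ y ∈ I, w y ≤ w₁
  neg_log_mem : -Real.log β ∈ I
  log_mem : γ ≠ 0 → Real.log γ ∈ I
  step_mem : ∀ m : Multiset ℝ, (∀ y ∈ m, y ∈ I) → m.card + 1 ≤ Δ →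
    logMessage β γ (x * Real.exp m.sum) ∈ I
  step_le : ∀ m : Multiset ℝ, (∀ y ∈ m, y ∈ I) → m.card + 1 ≤ Δ →
    (m.map w).sum * messageSlope β γ (x * Real.exp m.sum) ≤
      (1 - η) * w (logMessage β γ (x * Real.exp m.sum))

/-- The messages in a complex neighbourhood of `exp I`, together with `γ`. -/
def thickenedMessages (γ : ℝ) (I : Set ℝ) (w : ℝ → ℝ) (r : ℝ) : Set ℂ :=
  {c | c = γ ∨ ∃ y ∈ I, ∃ Z : ℂ, ‖Z - y‖ < r * w y ∧ c = Complex.exp Z}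

/-- The alternative of product 0 is there because for `γ = 0` the message `γ` has no logarithm. -/
theorem exists_prod_eq_exp {γ r : ℝ} {I : Set ℝ} {w : ℝ → ℝ} (hγ : 0 ≤ γ)
    (hlog : γ ≠ 0 → Real.log γ ∈ I) (hr : 0 < r) (hw : ∀ y ∈ I, 0 < w y) (m : Multiset ℂ)
    (hm : ∀ c ∈ m, c ∈ thickenedMessages γ I w r) :
    m.prod = 0 ∨ ∃ Y : Multiset ℝ, Y.card = m.card ∧ (∀ y ∈ Y, y ∈ I) ∧
      ∃ σ : ℂ, ‖σ‖ ≤ r * (Y.map w).sum ∧ m.prod = Complex.exp (Y.sum + σ) := by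
  induction m using Multiset.induction_on with
  | empty => right; exact ⟨0, rfl, by simp, 0, by simp⟩
  | cons c m ih =>
    rw [Multiset.prod_cons]
    rcases ih fun c hc => hm c (Multiset.mem_cons_of_mem hc) with h | ⟨Y, hY1, hY2, σ, hσ, h⟩
    · left; rw [h, mul_zero]
    have hc : c = 0 ∨ ∃ y ∈ I, ∃ Z : ℂ, ‖Z - y‖ < r * w y ∧ c = Complex.exp Z := by
      rcases hm c (Multiset.mem_cons_self _ _) with rfl | h
      · by_cases hγ0 : γ = 0
        · left; simp [hγ0]
        · right
          refine ⟨_, hlog hγ0, Real.log γ, ?_, ?_⟩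
          · simpa using mul_pos hr (hw _ (hlog hγ0))
          · rw [← Complex.ofReal_exp, Real.exp_log (hγ.lt_of_ne' hγ0)]
      · exact Or.inr h
    rcases hc with rfl | ⟨y, hy, Z, hZ, rfl⟩
    · left; rw [zero_mul]
    · right
      refine ⟨y ::ₘ Y, by simp [hY1], ?_, (Z - y) + σ, ?_, ?_⟩
      · intro a ha
        rcases Multiset.mem_cons.1 ha with rfl | ha
        exacts [hy, hY2 a ha]
      · rw [Multiset.map_cons, Multiset.sum_cons, mul_add]
        exact (norm_add_le _ _).trans (add_le_add hZ.le hσ)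
      · rw [h, ← Complex.exp_add, Multiset.sum_cons]
        congr 1
        push_cast; ring

/-- A small complex perturbation of the ratio moves the logarithmic message by at most the slope
times the relative perturbation, up to the factor `(1 + θ) / (1 - θ)`. -/
theorem exists_log_message_near {β γ f θ a : ℝ} {f' : ℂ} (hβ : 0 < β) (hγ : 0 ≤ γ) (hf : 0 ≤ f)
    (hθ : 0 < θ) (hθ1 : θ ≤ 1 / 2) (ha : ‖f' - f‖ ≤ a) (haβ : a ≤ θ * β)
    (haθ : 2 * |β * γ - 1| * a ≤ θ * β) :
    f' + β ≠ 0 ∧ ∃ Z : ℂ, (γ * f' + 1) / (f' + β) = Complex.exp Z ∧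
      ‖Z - logMessage β γ f‖ ≤
        (1 + θ) / (1 - θ) * (|β * γ - 1| * a / ((γ * f + 1) * (f + β))) := by
  have hfβ : 0 < f + β := by linarith
  have hγf : 0 < γ * f + 1 := by positivity
  have hθ0 : 0 < 1 - θ := by linarith
  have ha0 : 0 ≤ a := (norm_nonneg _).trans ha
  have hlow : (1 - θ) * (f + β) ≤ ‖f' + β‖ := by
    have h1 : ‖((f + β : ℝ) : ℂ)‖ - ‖(f : ℂ) - f'‖ ≤ ‖((f + β : ℝ) : ℂ) - ((f : ℂ) - f')‖ :=
      norm_sub_norm_le _ _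
    rw [Complex.norm_real, Real.norm_of_nonneg hfβ.le, norm_sub_rev (f : ℂ)] at h1
    have h2 : ((f + β : ℝ) : ℂ) - ((f : ℂ) - f') = f' + β := by push_cast; ring
    rw [h2] at h1
    nlinarith
  have hpos : 0 < (1 - θ) * (f + β) := by positivity
  have hne : f' + β ≠ 0 := norm_pos_iff.1 (hpos.trans_le hlow)
  have hfβ' : (f : ℂ) + β ≠ 0 := by exact_mod_cast hfβ.ne'
  have hγf' : (γ : ℂ) * f + 1 ≠ 0 := by exact_mod_cast hγf.ne'
  refine ⟨hne, ?_⟩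
  -- The message of `f'` is `1 + ε` times the message of `f`.
  set ε : ℂ := ((β : ℂ) * γ - 1) * (f' - f) / ((f' + β) * (γ * f + 1)) with hε
  set A := |β * γ - 1| * a / ((γ * f + 1) * (f + β)) with hA
  have hA0 : 0 ≤ A := by positivity
  have hεA : ‖ε‖ ≤ A / (1 - θ) := by
    have h1 : ‖(β : ℂ) * γ - 1‖ = |β * γ - 1| := by
      rw [← Complex.ofReal_mul, ← Complex.ofReal_one, ← Complex.ofReal_sub, Complex.norm_real,
        Real.norm_eq_abs]
    have h2 : ‖(γ : ℂ) * f + 1‖ = γ * f + 1 := by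
      rw [← Complex.ofReal_mul, ← Complex.ofReal_one, ← Complex.ofReal_add, Complex.norm_real,
        Real.norm_of_nonneg hγf.le]
    rw [hε, norm_div, norm_mul, norm_mul, h1, h2, hA, div_div]
    apply div_le_div₀ (by positivity) (mul_le_mul_of_nonneg_left ha (abs_nonneg _))
      (by positivity)
    calc (γ * f + 1) * (f + β) * (1 - θ) = ((1 - θ) * (f + β)) * (γ * f + 1) := by ring
      _ ≤ _ := mul_le_mul_of_nonneg_right hlow hγf.le
  have hAθ : A / (1 - θ) ≤ θ := by
    have h1 : A ≤ |β * γ - 1| * a / β := by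
      rw [hA]
      apply div_le_div_of_nonneg_left (by positivity) hβ
      nlinarith [mul_nonneg hγ hf]
    have h2 : |β * γ - 1| * a / β ≤ θ / 2 := by
      rw [div_le_iff₀ hβ]; linarith
    rw [div_le_iff₀ hθ0]
    nlinarith
  have hεθ : ‖ε‖ ≤ θ := hεA.trans hAθ
  have hε1 : ‖ε‖ < 1 := by linarith
  have hlog : ‖Complex.log (1 + ε)‖ ≤ (1 + θ) * ‖ε‖ := by
    refine (Complex.norm_log_one_add_le hε1).trans ?_
    have h1 : (1 - ‖ε‖)⁻¹ ≤ 2 := by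
      rw [inv_le_comm₀ (by linarith) (by norm_num)]; linarith
    have h2 : ‖ε‖ ^ 2 * (1 - ‖ε‖)⁻¹ ≤ ‖ε‖ ^ 2 * 2 :=
      mul_le_mul_of_nonneg_left h1 (by positivity)
    nlinarith [norm_nonneg ε]
  have hε0 : 1 + ε ≠ 0 := by
    intro h
    have : ε = -1 := by linear_combination h
    rw [this, norm_neg, norm_one] at hε1
    exact lt_irrefl _ hε1
  refine ⟨logMessage β γ f + Complex.log (1 + ε), ?_, ?_⟩
  · rw [Complex.exp_add, Complex.exp_log hε0, ← Complex.ofReal_exp, logMessage,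
      Real.exp_log (by positivity), hε]
    push_cast
    field_simp
    ring
  · rw [add_sub_cancel_left]
    refine hlog.trans ?_
    calc (1 + θ) * ‖ε‖ ≤ (1 + θ) * (A / (1 - θ)) :=
          mul_le_mul_of_nonneg_left hεA (by linarith)
      _ = _ := by ring

theorem mul_div_le_messageSlope {β γ f θ r T a b : ℝ} (hβ : 0 < β) (hγ : 0 ≤ γ) (hf : 0 ≤ f)
    (hb : 0 ≤ b) (ha : a ≤ (1 + θ) * f * (r * T) + b) :
    |β * γ - 1| * a / ((γ * f + 1) * (f + β)) ≤
      (1 + θ) * (r * (T * messageSlope β γ f)) + |β * γ - 1| * b / β := by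
  have hden : 0 < (γ * f + 1) * (f + β) := by positivity
  have h1 : |β * γ - 1| * a ≤ |β * γ - 1| * ((1 + θ) * f * (r * T) + b) :=
    mul_le_mul_of_nonneg_left ha (abs_nonneg _)
  have h2 : |β * γ - 1| * ((1 + θ) * f * (r * T) + b) / ((γ * f + 1) * (f + β)) =
      (1 + θ) * (r * (T * messageSlope β γ f)) +
        |β * γ - 1| * b / ((γ * f + 1) * (f + β)) := by
    rw [messageSlope]; ring
  have h3 : |β * γ - 1| * b / ((γ * f + 1) * (f + β)) ≤ |β * γ - 1| * b / β := by
    apply div_le_div_of_nonneg_left (by positivity) hβ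
    nlinarith [mul_nonneg hγ hf, mul_nonneg (mul_nonneg hγ hf) hf,
      mul_nonneg (mul_nonneg hγ hf) hβ.le]
  calc _ ≤ |β * γ - 1| * ((1 + θ) * f * (r * T) + b) / ((γ * f + 1) * (f + β)) :=
        div_le_div_of_nonneg_right h1 hden.le
    _ ≤ _ := by rw [h2]; linarith

/-- The contraction margin `η` is split in two: one half absorbs the second-order factors in `θ`,
the other the error `c` caused by moving the activity. -/
theorem perturbed_step_lt {η θ r w₀ wY A c : ℝ} (hη : 0 < η) (hη1 : η ≤ 1) (hθ : θ = η / 8)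
    (hr : 0 < r) (hw₀ : 0 < w₀) (hge : w₀ ≤ wY) (hc0 : 0 ≤ c) (hc : 3 * c < η / 2 * (r * w₀))
    (hA : A ≤ (1 + θ) * (r * ((1 - η) * wY)) + c) : (1 + θ) / (1 - θ) * A < r * wY := by
  have hθ0 : 0 < θ := by rw [hθ]; positivity
  have h1θ : 0 < 1 - θ := by rw [hθ]; linarith
  rw [div_mul_eq_mul_div, div_lt_iff₀ h1θ]
  have hrw : 0 < r * wY := mul_pos hr (hw₀.trans_le hge)
  have hrw' : r * w₀ ≤ r * wY := mul_le_mul_of_nonneg_left hge hr.le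
  have h5 : (1 + θ) * A ≤ (1 + θ) * ((1 + θ) * (r * ((1 - η) * wY)) + c) := by gcongr
  have h6 : (1 + θ) * (1 + θ) * (1 - η) ≤ (1 - η / 2) * (1 - θ) := by
    rw [hθ]; nlinarith [sq_nonneg η, pow_pos hη 3]
  have h7 : (1 + θ) * (1 + θ) * (1 - η) * (r * wY) ≤ (1 - η / 2) * (1 - θ) * (r * wY) := by
    gcongr
  have h8 : (1 + θ) * c ≤ (1 - θ) * (3 * c) := by
    have : 0 ≤ c * (2 - 4 * θ) := mul_nonneg hc0 (by rw [hθ]; linarith)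
    linarith
  have h9 : (1 - θ) * (3 * c) < (1 - θ) * (η / 2 * (r * wY)) := by
    apply mul_lt_mul_of_pos_left _ h1θ
    exact hc.trans_le (mul_le_mul_of_nonneg_left hrw' (by positivity))
  linarith

theorem RealContraction.eventually_messageInvariant {β γ x : ℝ} {Δ : ℕ} {I : Set ℝ} {w : ℝ → ℝ}
    {η w₀ w₁ L : ℝ} (hβ : 0 < β) (hγ : 0 ≤ γ) (hx : 0 ≤ x)
    (h : RealContraction β γ x Δ I w η w₀ w₁ L) (hη : 0 < η) (hη1 : η ≤ 1) (hw₀ : 0 < w₀) :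
    ∀ᶠ z : ℂ in nhds (x : ℂ), ∃ U, MessageInvariant β γ z Δ U := by
  have hw : ∀ y ∈ I, 0 < w y := fun y hy => hw₀.trans_le (h.weight_ge y hy)
  have hw₁ : 0 < w₁ := (hw _ h.neg_log_mem).trans_le (h.weight_le _ h.neg_log_mem)
  have hL : 0 ≤ L := (abs_nonneg _).trans (h.abs_le _ h.neg_log_mem)
  set θ := η / 8 with hθ
  have hθ0 : 0 < θ := by positivity
  have hθ1 : θ ≤ 1 / 2 := by rw [hθ]; linarith
  set B := Real.exp (Δ * L) with hB
  have hB0 : 0 < B := Real.exp_pos _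
  set D := |β * γ - 1| with hD
  have hD0 : 0 ≤ D := abs_nonneg _
  set K := Δ * w₁ + 1 with hK
  have hK0 : 0 < K := by positivity
  -- The constants are chosen in turn: `e` bounds the change of any ratio, the thickness `r` of the
  -- messages is small against `e`, and the distance `δ` of the activity is small against both `e`
  -- and `r`.
  obtain ⟨e, he0, he1, he2, he3⟩ : ∃ e : ℝ, 0 < e ∧ e ≤ θ * β ∧ 2 * D * e ≤ θ * β ∧ e < 1 := by
    refine ⟨min (θ * β / (2 * D + 1)) (1 / 2), by positivity, ?_, ?_,
      (min_le_right _ _).trans_lt (by norm_num)⟩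
    · refine (min_le_left _ _).trans ?_
      rw [div_le_iff₀ (by positivity)]
      nlinarith [mul_nonneg (mul_pos hθ0 hβ).le hD0]
    · have h1 := min_le_left (θ * β / (2 * D + 1)) (1 / 2)
      rw [le_div_iff₀ (by positivity)] at h1
      have h2 : (0 : ℝ) ≤ min (θ * β / (2 * D + 1)) (1 / 2) := by positivity
      nlinarith
  obtain ⟨r, hr0, hr1, hr2⟩ : ∃ r : ℝ, 0 < r ∧ r * K ≤ θ ∧ 2 * (x * B) * (r * K) ≤ e / 2 := by
    refine ⟨min θ (e / (4 * (x * B) + 4)) / K, by positivity, ?_, ?_⟩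
    · rw [div_mul_cancel₀ _ hK0.ne']; exact min_le_left _ _
    · rw [div_mul_cancel₀ _ hK0.ne']
      have h1 := min_le_right θ (e / (4 * (x * B) + 4))
      rw [le_div_iff₀ (by positivity)] at h1
      have h2 : 0 ≤ min θ (e / (4 * (x * B) + 4)) := by positivity
      nlinarith
  set C := 3 * B * D / β with hC
  have hC0 : 0 ≤ C := by positivity
  obtain ⟨δ, hδ0, hδ1, hδ2⟩ : ∃ δ : ℝ, 0 < δ ∧ 3 * B * δ ≤ e / 2 ∧
      3 * C * δ < η / 2 * (r * w₀) := by
    refine ⟨min (e / (6 * B)) (η * (r * w₀) / (6 * C + 6)), by positivity, ?_, ?_⟩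
    · have h1 := min_le_left (e / (6 * B)) (η * (r * w₀) / (6 * C + 6))
      rw [le_div_iff₀ (by positivity)] at h1
      linarith
    · have h1 := min_le_right (e / (6 * B)) (η * (r * w₀) / (6 * C + 6))
      rw [le_div_iff₀ (by positivity)] at h1
      have h2 : 0 < min (e / (6 * B)) (η * (r * w₀) / (6 * C + 6)) := by positivity
      nlinarith
  have hinv : (β : ℂ)⁻¹ ∈ thickenedMessages γ I w r := by
    refine Or.inr ⟨_, h.neg_log_mem, ((-Real.log β : ℝ) : ℂ), ?_, ?_⟩
    · simpa using mul_pos hr0 (hw _ h.neg_log_mem)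
    · rw [← Complex.ofReal_exp, Real.exp_neg, Real.exp_log hβ, Complex.ofReal_inv]
  rw [Metric.eventually_nhds_iff]
  refine ⟨δ, hδ0, fun z hz => ⟨thickenedMessages γ I w r, ?_⟩⟩
  rw [dist_eq_norm] at hz
  -- the perturbed ratio is close to the real one
  have near : ∀ m : Multiset ℂ, (∀ c ∈ m, c ∈ thickenedMessages γ I w r) → m.card ≤ Δ →
      m.prod = 0 ∨ ∃ Y : Multiset ℝ, Y.card = m.card ∧ (∀ y ∈ Y, y ∈ I) ∧
        ∃ a, ‖z * m.prod - ((x * Real.exp Y.sum : ℝ) : ℂ)‖ ≤ a ∧ a ≤ e ∧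
          a ≤ (1 + θ) * (x * Real.exp Y.sum) * (r * (Y.map w).sum) + 3 * B * δ := by
    intro m hm hcard
    rcases exists_prod_eq_exp hγ h.log_mem hr0 hw m hm with h0 | ⟨Y, hY1, hY2, σ, hσ, hprod⟩
    · exact Or.inl h0
    right
    refine ⟨Y, hY1, hY2, _, le_rfl, ?_⟩
    have hYcard : (Y.card : ℝ) ≤ Δ := by rw [hY1]; exact_mod_cast hcard
    have hsumw : (Y.map w).sum ≤ K := by
      have h1 : (Y.map w).sum ≤ (Y.map w).card • w₁ := by
        apply Multiset.sum_le_card_nsmul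
        intro a ha
        obtain ⟨y, hy, rfl⟩ := Multiset.mem_map.1 ha
        exact h.weight_le y (hY2 y hy)
      rw [Multiset.card_map, nsmul_eq_mul] at h1
      nlinarith
    have hsumY : Y.sum ≤ Δ * L := by
      have h1 : Y.sum ≤ Y.card • L :=
        Multiset.sum_le_card_nsmul _ _ fun y hy => (le_abs_self y).trans (h.abs_le y (hY2 y hy))
      rw [nsmul_eq_mul] at h1
      nlinarith
    have hexpY : Real.exp Y.sum ≤ B := Real.exp_le_exp.2 hsumY
    have hσK : ‖σ‖ ≤ r * K := hσ.trans (mul_le_mul_of_nonneg_left hsumw hr0.le)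
    have hσ1 : ‖σ‖ ≤ 1 := by linarith
    have hexp1 : ‖Complex.exp σ - 1‖ ≤ (1 + θ) * ‖σ‖ := by
      have h1 := Complex.norm_exp_sub_one_sub_id_le hσ1
      have h2 : ‖Complex.exp σ - 1‖ ≤ ‖Complex.exp σ - 1 - σ‖ + ‖σ‖ := by
        simpa using norm_add_le (Complex.exp σ - 1 - σ) σ
      nlinarith [norm_nonneg σ]
    have hexp3 : ‖Complex.exp σ‖ ≤ 3 := by
      have h1 := Complex.norm_exp_sub_one_le hσ1
      have h2 : ‖Complex.exp σ‖ ≤ ‖Complex.exp σ - 1‖ + ‖(1 : ℂ)‖ := by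
        simpa using norm_add_le (Complex.exp σ - 1) 1
      rw [norm_one] at h2
      linarith
    have hmain : ‖z * m.prod - ((x * Real.exp Y.sum : ℝ) : ℂ)‖ ≤
        (1 + θ) * (x * Real.exp Y.sum) * ‖σ‖ + 3 * B * δ := by
      have h1 : z * m.prod - ((x * Real.exp Y.sum : ℝ) : ℂ) =
          ((x * Real.exp Y.sum : ℝ) : ℂ) * (Complex.exp σ - 1) +
            (z - x) * (((Real.exp Y.sum : ℝ) : ℂ) * Complex.exp σ) := by
        rw [hprod, Complex.exp_add]; push_cast; ring
      rw [h1]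
      refine (norm_add_le _ _).trans (add_le_add ?_ ?_)
      · rw [norm_mul, Complex.norm_real, Real.norm_of_nonneg (by positivity)]
        calc _ ≤ (x * Real.exp Y.sum) * ((1 + θ) * ‖σ‖) :=
              mul_le_mul_of_nonneg_left hexp1 (by positivity)
          _ = _ := by ring
      · rw [norm_mul, norm_mul, Complex.norm_real, Real.norm_of_nonneg (Real.exp_pos _).le]
        calc _ ≤ δ * (B * 3) := by gcongr
          _ = _ := by ring
    constructor
    · have h1 : (1 + θ) * (x * Real.exp Y.sum) * ‖σ‖ ≤ 2 * (x * B) * (r * K) := by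
        gcongr
        linarith
      linarith
    · refine hmain.trans ?_
      gcongr
  have hmsg : ∀ m : Multiset ℂ, (∀ c ∈ m, c ∈ thickenedMessages γ I w r) → m.card + 1 ≤ Δ →
      z * m.prod + β ≠ 0 ∧ (γ * (z * m.prod) + 1) / (z * m.prod + β) ∈
        thickenedMessages γ I w r := by
    intro m hm hcard
    rcases near m hm (by omega) with h0 | ⟨Y, hY1, hY2, a, ha1, ha2, ha3⟩
    · rw [h0]
      simpa [hβ.ne'] using hinv
    have hY3 : Y.card + 1 ≤ Δ := by omega
    set f := x * Real.exp Y.sum with hf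
    have hf0 : 0 ≤ f := by positivity
    obtain ⟨hne, Z, hZ1, hZ2⟩ := exists_log_message_near hβ hγ hf0 hθ0 hθ1 ha1 (ha2.trans he1)
      ((mul_le_mul_of_nonneg_left ha2 (by positivity)).trans he2)
    refine ⟨hne, Or.inr ⟨_, h.step_mem Y hY2 hY3, Z, hZ2.trans_lt ?_, hZ1⟩⟩
    have hstep := h.step_le Y hY2 hY3
    rw [← hf] at hstep ⊢
    have hge := h.weight_ge _ (h.step_mem Y hY2 hY3)
    rw [← hf] at hge
    set wY := w (logMessage β γ f)
    have h1 : D * a / ((γ * f + 1) * (f + β)) ≤ (1 + θ) * (r * ((1 - η) * wY)) + C * δ := by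
      have h2 := mul_div_le_messageSlope hβ hγ hf0 (by positivity) ha3
      have h3 : |β * γ - 1| * (3 * B * δ) / β = C * δ := by rw [hC, hD]; ring
      rw [h3] at h2
      refine h2.trans (add_le_add_left ?_ _)
      have : r * ((Y.map w).sum * messageSlope β γ f) ≤ r * ((1 - η) * wY) :=
        mul_le_mul_of_nonneg_left hstep hr0.le
      exact mul_le_mul_of_nonneg_left this (by linarith)
    exact perturbed_step_lt hη hη1 hθ hr0 hw₀ hge (by positivity) (by linarith) h1
  refine ⟨hinv, Or.inl rfl, fun m hm hc => (hmsg m hm hc).1, fun m hm hc => (hmsg m hm hc).2, ?_⟩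
  -- The real ratio is nonnegative, so `-1` is at distance at least `1 > e` from it.
  intro m hm hcard heq
  rcases near m hm hcard with h0 | ⟨Y, -, -, a, ha1, ha2, -⟩
  · rw [h0] at heq; simp at heq
  · have hf0 : 0 ≤ x * Real.exp Y.sum := by positivity
    have h1 : -1 - ((x * Real.exp Y.sum : ℝ) : ℂ) = ((-(1 + x * Real.exp Y.sum) : ℝ) : ℂ) := by
      push_cast; ring
    rw [heq, h1, Complex.norm_real, norm_neg, Real.norm_of_nonneg (by linarith)] at ha1
    linarith

/-! ### Contraction for ferromagnetic systems -/

/-- The function whose sign controls the contraction for ferromagnetic systems, with `t` the ratio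
divided by `√(β / γ)`. -/
noncomputable def ferroGap (s C t : ℝ) : ℝ :=
  C * (s * (t + t⁻¹ - 2)) + (s ^ 2 - 1) * Real.log t -
    Real.log ((1 + s * t) / (t + s)) * (1 + s ^ 2 + s * (t + t⁻¹))

theorem hasDerivAt_ferroGap {s C t : ℝ} (hs : 0 < s) (ht : 0 < t) :
    HasDerivAt (ferroGap s C)
      (s * (1 - (t ^ 2)⁻¹) * (C - Real.log ((1 + s * t) / (t + s)))) t := by
  have h1 : HasDerivAt (fun t : ℝ => t⁻¹) (-(t ^ 2)⁻¹) t := hasDerivAt_inv ht.ne'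
  have h2 : HasDerivAt (fun t : ℝ => t + t⁻¹) (1 + -(t ^ 2)⁻¹) t := (hasDerivAt_id' t).add h1
  have h3 : HasDerivAt (fun t : ℝ => (1 + s * t) / (t + s))
      ((s * (t + s) - (1 + s * t) * 1) / (t + s) ^ 2) t := by
    have e1 : HasDerivAt (fun t : ℝ => 1 + s * t) s t := by
      simpa using ((hasDerivAt_id' t).const_mul s).const_add 1
    exact e1.div ((hasDerivAt_id' t).add_const s) (by positivity)
  have h4 := h3.log (by positivity)
  have h5 := (((h2.sub_const 2).const_mul s).const_mul C).add
    ((Real.hasDerivAt_log ht.ne').const_mul (s ^ 2 - 1))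
  have h6 := h5.sub (h4.mul ((h2.const_mul s).const_add (1 + s ^ 2)))
  refine h6.congr_deriv ?_
  generalize Real.log ((1 + s * t) / (t + s)) = u
  have : 0 < 1 + s * t := by positivity
  field_simp
  ring

/-- The logarithm of `t` cancels in the derivative, whose remaining factor `C - log ((1 + s t) / (t
+ s))` is nonnegative since the quotient is at most `s`. So the minimum is at `t = 1`, with value 0.
-/
theorem ferroGap_nonneg {s C t : ℝ} (hs : 1 < s) (hC : Real.log s ≤ C) (ht : 0 < t) :
    0 ≤ ferroGap s C t := by
  have hs0 : 0 < s := by linarith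
  have h1 : ferroGap s C 1 = 0 := by
    have : (1 + s * 1) / (1 + s) = 1 := by
      rw [mul_one, div_self (by linarith)]
    rw [ferroGap, this]
    norm_num
  have hu : ∀ r : ℝ, 0 < r → 0 ≤ C - Real.log ((1 + s * r) / (r + s)) := by
    intro r hr
    have : (1 + s * r) / (r + s) ≤ s := by
      rw [div_le_iff₀ (by positivity)]; nlinarith
    have := Real.log_le_log (by positivity) this
    linarith
  rcases le_total 1 t with h | h
  · have hmono : MonotoneOn (ferroGap s C) (Set.Icc 1 t) := by
      refine monotoneOn_of_deriv_nonneg (convex_Icc _ _) ?_ ?_ ?_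
      · intro r hr
        exact (hasDerivAt_ferroGap hs0 (by linarith [hr.1])).continuousAt.continuousWithinAt
      · intro r hr
        rw [interior_Icc] at hr
        exact (hasDerivAt_ferroGap hs0
          (by linarith [hr.1])).differentiableAt.differentiableWithinAt
      · intro r hr
        rw [interior_Icc] at hr
        have hr0 : 0 < r := by linarith [hr.1]
        rw [(hasDerivAt_ferroGap hs0 hr0).deriv]
        refine mul_nonneg (mul_nonneg hs0.le ?_) (hu r hr0)
        rw [sub_nonneg]
        exact inv_le_one_of_one_le₀ (one_le_pow₀ hr.1.le)
    rw [← h1]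
    exact hmono ⟨le_rfl, h⟩ ⟨h, le_rfl⟩ h
  · have hanti : AntitoneOn (ferroGap s C) (Set.Icc t 1) := by
      refine antitoneOn_of_deriv_nonpos (convex_Icc _ _) ?_ ?_ ?_
      · intro r hr
        exact (hasDerivAt_ferroGap hs0 (by linarith [hr.1])).continuousAt.continuousWithinAt
      · intro r hr
        rw [interior_Icc] at hr
        exact (hasDerivAt_ferroGap hs0
          (by linarith [hr.1])).differentiableAt.differentiableWithinAt
      · intro r hr
        rw [interior_Icc] at hr
        have hr0 : 0 < r := by linarith [hr.1]
        rw [(hasDerivAt_ferroGap hs0 hr0).deriv]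
        refine mul_nonpos_of_nonpos_of_nonneg (mul_nonpos_of_nonneg_of_nonpos hs0.le ?_) (hu r hr0)
        rw [sub_nonpos]
        exact (one_le_inv₀ (by positivity)).2 (pow_le_one₀ hr0.le hr.2.le)
    rw [← h1]
    exact hanti ⟨le_rfl, h⟩ ⟨h, le_rfl⟩ h

/-- The logarithm of the threshold for the largest ratio, in ferromagnetic systems. -/
noncomputable def ferroLogThreshold (β γ : ℝ) : ℝ :=
  Real.sqrt (β * γ) / (Real.sqrt (β * γ) - 1) * Real.log (β / γ) +
    (2 * Real.sqrt (β * γ) / (Real.sqrt (β * γ) - 1) - 1) * Real.log (max 1 γ)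

/-- After the substitution `x = √(β / γ) t` and clearing the denominator of the slope, this is
`ferroGap ≥ 0` with `C = log √(β / γ) + log (max 1 γ)`. The threshold is the value giving equality
at `t = 1`. -/
theorem messageSlope_mul_le {β γ x : ℝ} (hγ : 0 < γ) (hβγ : 1 < β * γ) (hx : 0 < x) :
    messageSlope β γ x * (ferroLogThreshold β γ - Real.log x) ≤
      Real.log (max 1 γ) - logMessage β γ x := by
  have hβ : 0 < β := by
    by_contra! h
    nlinarith
  set κ := Real.sqrt (β / γ) with hκ
  set s := Real.sqrt (β * γ) with hs
  set M := max 1 γ with hM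
  have hκ0 : 0 < κ := Real.sqrt_pos.2 (by positivity)
  have hs1 : 1 < s := by rw [hs]; exact Real.lt_sqrt_of_sq_lt (by simpa using hβγ)
  have hκ2 : κ ^ 2 = β / γ := Real.sq_sqrt (by positivity)
  have hsκ : s = γ * κ := by
    rw [hs, hκ, Real.sqrt_eq_iff_mul_self_eq (by positivity) (by positivity)]
    have : κ ^ 2 * γ = β := by rw [hκ2]; field_simp
    nlinarith
  have hβκ : β = s * κ := by
    rw [hsκ, mul_assoc, ← pow_two, hκ2]; field_simp
  have hM0 : 0 < M := lt_of_lt_of_le one_pos (le_max_left _ _)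
  obtain ⟨t, ht, rfl⟩ : ∃ t, 0 < t ∧ x = κ * t := ⟨x / κ, by positivity, by field_simp⟩
  have hC : Real.log s ≤ Real.log κ + Real.log M := by
    rw [← Real.log_mul hκ0.ne' hM0.ne', hsκ, mul_comm γ]
    exact Real.log_le_log (by positivity) (mul_le_mul_of_nonneg_left (le_max_right _ _) hκ0.le)
  have hgap := ferroGap_nonneg hs1 hC ht
  have hlogκ : Real.log (β / γ) = 2 * Real.log κ := by
    rw [← hκ2, Real.log_pow]; norm_num
  have hP : 0 < 1 + s ^ 2 + s * (t + t⁻¹) := by positivity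
  have hslope : messageSlope β γ (κ * t) = (s ^ 2 - 1) / (1 + s ^ 2 + s * (t + t⁻¹)) := by
    have h1 : β * γ = s ^ 2 := by rw [hβκ]; nlinarith
    have h2 : γ * (κ * t) = s * t := by rw [hsκ]; ring
    have h3 : 0 < s ^ 2 - 1 := by nlinarith
    rw [messageSlope, h1, h2, abs_of_pos h3, hβκ]
    have : 0 < s := by linarith
    field_simp
    ring
  have hmsg : logMessage β γ (κ * t) = Real.log ((1 + s * t) / (t + s)) - Real.log κ := by
    have h2 : γ * (κ * t) = s * t := by rw [hsκ]; ring
    have : 0 < s := by linarith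
    rw [logMessage, h2, ← Real.log_div (by positivity) hκ0.ne', hβκ]
    congr 1
    field_simp
    ring
  rw [hslope, hmsg, div_mul_eq_mul_div, div_le_iff₀ hP, Real.log_mul hκ0.ne' ht.ne',
    ferroLogThreshold, hlogκ, ← hs]
  have hs1' : s - 1 ≠ 0 := by linarith
  have e : (s ^ 2 - 1) * (s / (s - 1) * (2 * Real.log κ) +
      (2 * s / (s - 1) - 1) * Real.log (max 1 γ)) =
      (s + 1) * (2 * s * Real.log κ + (s + 1) * Real.log (max 1 γ)) := by
    field_simp
    ring
  rw [ferroGap] at hgap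
  linear_combination hgap + e

theorem logMessage_mem_of_ferro {β γ f : ℝ} (hβ : 0 < β) (hγ : 0 < γ) (hβγ : 1 < β * γ)
    (hf : 0 ≤ f) : logMessage β γ f ∈ Set.Icc (-Real.log β) (Real.log γ) := by
  have h1 : 0 < f + β := by linarith
  constructor
  · rw [← Real.log_inv, logMessage]
    refine Real.log_le_log (by positivity) ?_
    rw [le_div_iff₀ h1, inv_mul_le_iff₀ hβ]
    nlinarith
  · refine Real.log_le_log (by positivity) ?_
    rw [div_le_iff₀ h1]
    nlinarith

/-- The ratio with logarithmic message `y`. -/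
noncomputable def ratioOf (β γ y : ℝ) : ℝ := (β * Real.exp y - 1) / (γ - Real.exp y)

theorem ratioOf_logMessage {β γ f : ℝ} (hβ : 0 < β) (hγ : 0 ≤ γ) (hβγ : β * γ ≠ 1)
    (hf : 0 ≤ f) : ratioOf β γ (logMessage β γ f) = f := by
  have h1 : 0 < f + β := by linarith
  have h2 : β * γ - 1 ≠ 0 := sub_ne_zero.2 hβγ
  rw [ratioOf, logMessage, Real.exp_log (by positivity)]
  have h3 : γ - (γ * f + 1) / (f + β) = (β * γ - 1) / (f + β) := by field_simp; ring
  have h4 : β * ((γ * f + 1) / (f + β)) - 1 = (β * γ - 1) * f / (f + β) := by field_simp; ring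
  rw [h3, h4]
  field_simp

theorem realContraction_of_ferroPos {β γ x₀ x : ℝ} {Δ : ℕ} (hβ : 0 < β) (hγ : 0 ≤ γ)
    (h : FerroPos β γ x₀ Δ) (hx : 0 ≤ x) (hxx : x ≤ x₀) :
    ∃ (I : Set ℝ) (w : ℝ → ℝ) (η w₀ w₁ L : ℝ), 0 < η ∧ η ≤ 1 ∧ 0 < w₀ ∧
      RealContraction β γ x Δ I w η w₀ w₁ L := by
  obtain ⟨hβγ, hx₀, hlt⟩ := h
  have hγ0 : 0 < γ := hγ.lt_of_ne (by rintro rfl; simp at hβγ; linarith)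
  set M := max 1 γ with hM
  have hM0 : 0 < M := lt_of_lt_of_le one_pos (le_max_left _ _)
  have hM1 : 0 ≤ Real.log M := Real.log_nonneg (le_max_left _ _)
  have hγM : Real.log γ ≤ Real.log M := Real.log_le_log hγ0 (le_max_right _ _)
  set T := ferroLogThreshold β γ with hT
  have hlog : Real.log x₀ < T - (Δ - 1) * Real.log M := by
    have h1 := Real.log_lt_log hx₀ hlt
    rw [Real.log_mul (by positivity) (by positivity), Real.log_rpow (by positivity),
      Real.log_rpow hM0] at h1
    rw [hT, ferroLogThreshold, ← hM]
    linarith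
  set ε := (T - (Δ - 1) * Real.log M - Real.log x₀) / (Δ + 1) with hε
  have hε0 : 0 < ε := div_pos (by linarith) (by positivity)
  have hεΔ : Δ * ε ≤ T - (Δ - 1) * Real.log M - Real.log x₀ := by
    have : (Δ + 1) * ε = T - (Δ - 1) * Real.log M - Real.log x₀ := by
      rw [hε]; field_simp
    linarith
  have hlogγβ : -Real.log β ≤ Real.log γ := by
    have := Real.log_pos hβγ
    rw [Real.log_mul hβ.ne' hγ0.ne'] at this
    linarith
  -- Chosen so that the contraction bound at output ratio `f` follows from `∑ w(y) ≤ T - log f`.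
  -- Since `log f = log x + ∑ y`, a weight bounded by `log M - y`, up to `ε`, suffices. The positive
  -- part and `ε` only make the weight positive.
  set ψ : ℝ → ℝ := fun y => messageSlope β γ (ratioOf β γ y) * (T - Real.log (ratioOf β γ y))
    with hψ
  have hψle : ∀ y ∈ Set.Icc (-Real.log β) (Real.log γ), max 0 (ψ y) ≤ Real.log M - y := by
    intro y hy
    refine max_le (by linarith [hy.2]) ?_
    rcases hy.1.eq_or_lt with h1 | h1
    · have : ratioOf β γ y = 0 := by
        rw [ratioOf, ← h1, Real.exp_neg, Real.exp_log hβ, mul_inv_cancel₀ hβ.ne']; simp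
      simp only [hψ, this, messageSlope, mul_zero, zero_div, zero_mul]
      linarith [hy.2]
    -- At `y = log γ` the true ratio is infinite; division by zero makes `ratioOf` equal to 0 there,
    -- and `ψ` vanishes.
    rcases hy.2.eq_or_lt with h2 | h2
    · have : ratioOf β γ y = 0 := by
        rw [ratioOf, h2, Real.exp_log hγ0]; simp
      simp only [hψ, this, messageSlope, mul_zero, zero_div, zero_mul]
      linarith
    · have h3 : 1 < β * Real.exp y := by
        rw [← Real.log_inv, Real.log_lt_iff_lt_exp (by positivity)] at h1
        rwa [inv_lt_iff_one_lt_mul₀' hβ] at h1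
      have h4 : Real.exp y < γ := (Real.lt_log_iff_exp_lt hγ0).1 h2
      have h5 : 0 < ratioOf β γ y := div_pos (by linarith) (by linarith)
      have h6 : logMessage β γ (ratioOf β γ y) = y := by
        have h7 : γ - Real.exp y ≠ 0 := by linarith
        have h8 : β * γ - 1 ≠ 0 := by linarith
        have h9 : γ * ratioOf β γ y + 1 = (β * γ - 1) * Real.exp y / (γ - Real.exp y) := by
          rw [ratioOf]; field_simp; ring
        have h10 : ratioOf β γ y + β = (β * γ - 1) / (γ - Real.exp y) := by
          rw [ratioOf]; field_simp; ring
        rw [logMessage, h9, h10]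
        have : (β * γ - 1) * Real.exp y / (γ - Real.exp y) / ((β * γ - 1) / (γ - Real.exp y)) =
          Real.exp y := by field_simp
        rw [this, Real.log_exp]
      have := messageSlope_mul_le hγ0 hβγ h5
      rw [h6] at this
      exact this
  set w₁ := Real.log M + Real.log β + ε with hw₁
  have hw₁ε : ε ≤ w₁ := by
    rw [hw₁]; linarith
  have hw₁0 : 0 < w₁ := by linarith
  have hwle : ∀ y ∈ Set.Icc (-Real.log β) (Real.log γ), max 0 (ψ y) + ε ≤ w₁ := by
    intro y hy
    have := hψle y hy
    rw [hw₁]; linarith [hy.1]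
  have hstep : ∀ m : Multiset ℝ, logMessage β γ (x * Real.exp m.sum) ∈
      Set.Icc (-Real.log β) (Real.log γ) := fun m =>
    logMessage_mem_of_ferro hβ hγ0 hβγ (by positivity)
  refine ⟨Set.Icc (-Real.log β) (Real.log γ), fun y => max 0 (ψ y) + ε, ε / w₁, ε, w₁,
    |Real.log β| + |Real.log γ|, by positivity, (div_le_one hw₁0).2 hw₁ε, hε0, ?_, ?_, hwle,
    ⟨le_rfl, hlogγβ⟩, fun _ => ⟨hlogγβ, le_rfl⟩, fun m _ _ => hstep m, ?_⟩
  · intro y hy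
    have h1 := neg_abs_le (Real.log β)
    have h2 := le_abs_self (Real.log β)
    have h3 := neg_abs_le (Real.log γ)
    have h4 := le_abs_self (Real.log γ)
    rw [abs_le]
    constructor <;> linarith [hy.1, hy.2, abs_nonneg (Real.log β), abs_nonneg (Real.log γ)]
  · intro y _
    simp
  · intro m hm hcard
    have hη : (1 - ε / w₁) * (max 0 (ψ (logMessage β γ (x * Real.exp m.sum))) + ε) ≥
        max 0 (ψ (logMessage β γ (x * Real.exp m.sum))) := by
      have h1 := hwle _ (hstep m)
      have h2 : ε / w₁ * (max 0 (ψ (logMessage β γ (x * Real.exp m.sum))) + ε) ≤ ε := by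
        rw [div_mul_eq_mul_div, div_le_iff₀ hw₁0]
        exact mul_le_mul_of_nonneg_left h1 hε0.le
      linarith
    refine le_trans ?_ hη
    have hf : 0 ≤ x * Real.exp m.sum := by positivity
    have hψf : ψ (logMessage β γ (x * Real.exp m.sum)) =
        messageSlope β γ (x * Real.exp m.sum) * (T - Real.log (x * Real.exp m.sum)) := by
      simp only [hψ, ratioOf_logMessage hβ hγ hβγ.ne' hf]
    rcases hx.eq_or_lt with rfl | hx0
    · simp [messageSlope]
    refine le_trans ?_ (le_max_right _ _)
    rw [hψf, mul_comm]
    refine mul_le_mul_of_nonneg_left ?_ (by rw [messageSlope]; positivity)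
    rw [Real.log_mul hx0.ne' (Real.exp_pos _).ne', Real.log_exp]
    have hsum : (m.map fun y => max 0 (ψ y) + ε).sum ≤ m.card * (Real.log M + ε) - m.sum := by
      clear hη hψf hf hcard
      induction m using Multiset.induction_on with
      | empty => simp
      | cons a m ih =>
        have h1 := ih fun y hy => hm y (Multiset.mem_cons_of_mem hy)
        have h2 := hψle a (hm a (Multiset.mem_cons_self _ _))
        rw [Multiset.map_cons, Multiset.sum_cons, Multiset.card_cons, Multiset.sum_cons]
        push_cast
        linarith
    have hk : (m.card : ℝ) + 1 ≤ Δ := by exact_mod_cast hcard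
    have hlogx : Real.log x ≤ Real.log x₀ := Real.log_le_log hx0 hxx
    have h3 : m.card * (Real.log M + ε) ≤ (Δ - 1) * Real.log M + Δ * ε := by
      nlinarith
    linarith

/-! ### Shape of the uniqueness threshold `λ_c` -/

/-- The degree `d` for which `X` is the fixed point `x̂_d`. -/
noncomputable def critDegree (β γ X : ℝ) : ℝ := (γ * X + β / X + 1 + β * γ) / (1 - β * γ)

/-- The logarithm of the threshold `λ_c`, as a function of the fixed point. -/
noncomputable def logLambda (β γ X : ℝ) : ℝ :=
  Real.log X + critDegree β γ X * Real.log ((X + β) / (γ * X + 1))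

/-- Up to a negative factor, the derivative of `logLambda`. -/
noncomputable def critSign (β γ X : ℝ) : ℝ :=
  Real.log ((X + β) / (γ * X + 1)) - 2 * (1 - β * γ) * X / (β - γ * X ^ 2)

/-- The degrees at which `x̂_d` is a positive real number. -/
def IsCritRange (β γ d : ℝ) : Prop :=
  1 < d ∧ 1 + Real.sqrt (β * γ) ≤ d * (1 - Real.sqrt (β * γ))

section

variable {β γ : ℝ}

theorem gap_pos {X Y : ℝ} (hβ : 0 < β) (hγ : 0 ≤ γ) (hX : 0 ≤ X) (hXY : X < Y)
    (hY : γ * Y ^ 2 ≤ β) : 0 < β - γ * X ^ 2 := by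
  rcases hγ.eq_or_lt with rfl | hγ
  · simpa using hβ
  · have : X ^ 2 < Y ^ 2 := pow_lt_pow_left₀ hXY hX two_ne_zero
    have := mul_lt_mul_of_pos_left this hγ
    linarith

theorem hasDerivAt_logMessageInv {X : ℝ} (hβ : 0 < β) (hγ : 0 ≤ γ) (hX : 0 ≤ X) :
    HasDerivAt (fun X : ℝ => Real.log ((X + β) / (γ * X + 1)))
      ((1 - β * γ) / ((X + β) * (γ * X + 1))) X := by
  have h1 : 0 < X + β := by linarith
  have h2 : 0 < γ * X + 1 := by positivity
  have e1 : HasDerivAt (fun X : ℝ => γ * X + 1) γ X := by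
    simpa using ((hasDerivAt_id' X).const_mul γ).add_const 1
  have h3 := (((hasDerivAt_id' X).add_const β).div e1 h2.ne').log (div_pos h1 h2).ne'
  refine h3.congr_deriv ?_
  rw [Pi.div_apply]
  field_simp
  ring

theorem hasDerivAt_logLambda {X : ℝ} (hβ : 0 < β) (hγ : 0 ≤ γ) (hβγ : β * γ < 1) (hX : 0 < X)
    (hXβ : 0 < β - γ * X ^ 2) :
    HasDerivAt (logLambda β γ)
      (-((β - γ * X ^ 2) / (X ^ 2 * (1 - β * γ)) * critSign β γ X)) X := by
  have h0 : 0 < 1 - β * γ := by linarith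
  have h1 : HasDerivAt (critDegree β γ) ((γ - β / X ^ 2) / (1 - β * γ)) X := by
    have e1 : HasDerivAt (fun X : ℝ => β / X) (-(β / X ^ 2)) X := by
      refine ((hasDerivAt_inv hX.ne').const_mul β).congr_deriv ?_
      ring
    have e2 := ((((((hasDerivAt_id' X).const_mul γ).add e1).add_const 1).add_const
      (β * γ)).div_const (1 - β * γ))
    refine e2.congr_deriv ?_
    ring
  have h2 := (Real.hasDerivAt_log hX.ne').add (h1.mul (hasDerivAt_logMessageInv hβ hγ hX.le))
  refine h2.congr_deriv ?_
  have h3 : 0 < X + β := by linarith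
  have h4 : 0 < γ * X + 1 := by positivity
  have h5 : γ * X + β / X + 1 + β * γ = (X + β) * (γ * X + 1) / X := by field_simp; ring
  have h6 : γ - β / X ^ 2 = -((β - γ * X ^ 2) / X ^ 2) := by field_simp; ring
  rw [critSign, critDegree, h5, h6]
  generalize Real.log ((X + β) / (γ * X + 1)) = l
  generalize β - γ * X ^ 2 = e at hXβ ⊢
  generalize 1 - β * γ = g at h0 ⊢
  field_simp
  ring

/-- Hence `λ_c` has at most one turning point. As `critSign` equals `log β` at 0, it has none when
`β ≤ 1`. -/
theorem critSign_strictAnti {X Y : ℝ} (hβ : 0 < β) (hγ : 0 ≤ γ) (hβγ : β * γ < 1) (hX : 0 ≤ X)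
    (hXY : X < Y) (hY : 0 < β - γ * Y ^ 2) : critSign β γ Y < critSign β γ X := by
  have hpos : ∀ r ∈ Set.Icc X Y, 0 ≤ r ∧ 0 < β - γ * r ^ 2 := by
    intro r hr
    have hr0 := hX.trans hr.1
    refine ⟨hr0, ?_⟩
    have := mul_le_mul_of_nonneg_left (pow_le_pow_left₀ hr0 hr.2 2) hγ
    linarith
  have hder : ∀ r ∈ Set.Icc X Y, HasDerivAt (critSign β γ)
      ((1 - β * γ) / ((r + β) * (γ * r + 1)) -
        2 * (1 - β * γ) * (β + γ * r ^ 2) / (β - γ * r ^ 2) ^ 2) r := by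
    intro r hr
    obtain ⟨hr0, hr1⟩ := hpos r hr
    have e1 : HasDerivAt (fun r : ℝ => 2 * (1 - β * γ) * r) (2 * (1 - β * γ)) r := by
      simpa using (hasDerivAt_id' r).const_mul (2 * (1 - β * γ))
    have e2 : HasDerivAt (fun r : ℝ => β - γ * r ^ 2) (-(γ * (2 * r))) r := by
      simpa using ((hasDerivAt_pow 2 r).const_mul γ).const_sub β
    have := (hasDerivAt_logMessageInv hβ hγ hr0).sub (e1.div e2 hr1.ne')
    refine this.congr_deriv ?_
    congr 2
    ring
  have := strictAntiOn_of_deriv_neg (convex_Icc X Y)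
    (fun r hr => (hder r hr).continuousAt.continuousWithinAt) (f := critSign β γ) (by
      intro r hr
      have hr' := interior_subset hr
      obtain ⟨hr0, hr1⟩ := hpos r hr'
      rw [(hder r hr').deriv, sub_neg]
      have h1 : 0 < 1 - β * γ := by linarith
      have h2 : 0 < γ * r + 1 := by positivity
      have h3 : 0 < r + β := by linarith
      rw [div_lt_div_iff₀ (by positivity) (by positivity)]
      have h4 : 0 ≤ γ * r ^ 2 := by positivity
      have h5 : (r + β) * (γ * r + 1) = β + γ * r ^ 2 + (1 + β * γ) * r := by ring
      have h6 : 0 ≤ (1 + β * γ) * r := by positivity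
      rw [h5]
      have h7 : (β - γ * r ^ 2) ^ 2 <
          2 * (β + γ * r ^ 2) * (β + γ * r ^ 2 + (1 + β * γ) * r) := by
        have h8 : 0 ≤ (β + γ * r ^ 2) * ((1 + β * γ) * r) := by positivity
        nlinarith [mul_nonneg hβ.le h4, sq_nonneg (γ * r ^ 2), mul_pos hβ hβ]
      calc (1 - β * γ) * (β - γ * r ^ 2) ^ 2 <
          (1 - β * γ) * (2 * (β + γ * r ^ 2) * (β + γ * r ^ 2 + (1 + β * γ) * r)) :=
            mul_lt_mul_of_pos_left h7 h1
        _ = _ := by ring)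
  exact this ⟨le_rfl, hXY.le⟩ ⟨hXY.le, le_rfl⟩ hXY

theorem continuousOn_logLambda {X Y : ℝ} (hβ : 0 < β) (hγ : 0 ≤ γ) (hX : 0 < X) :
    ContinuousOn (logLambda β γ) (Set.Icc X Y) := by
  intro r hr
  have hr0 : 0 < r := hX.trans_le hr.1
  have h1 : ContinuousAt (fun X : ℝ => Real.log ((X + β) / (γ * X + 1))) r :=
    (hasDerivAt_logMessageInv hβ hγ hr0.le).continuousAt
  have h2 : ContinuousAt (critDegree β γ) r := by
    unfold critDegree
    have : ContinuousAt (fun X : ℝ => β / X) r := continuousAt_const.div continuousAt_id hr0.ne'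
    fun_prop
  exact ((Real.continuousAt_log hr0.ne').add (h2.mul h1)).continuousWithinAt

theorem logLambda_lt_of_critSign_neg {X Y : ℝ} (hβ : 0 < β) (hγ : 0 ≤ γ) (hβγ : β * γ < 1)
    (hX : 0 < X) (hXY : X < Y) (hY : γ * Y ^ 2 ≤ β)
    (h : ∀ r ∈ Set.Ioo X Y, critSign β γ r < 0) : logLambda β γ X < logLambda β γ Y := by
  refine strictMonoOn_of_deriv_pos (convex_Icc X Y) (continuousOn_logLambda hβ hγ hX) ?_
    ⟨le_rfl, hXY.le⟩ ⟨hXY.le, le_rfl⟩ hXY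
  intro r hr
  rw [interior_Icc] at hr
  have hr0 : 0 < r := hX.trans hr.1
  have hg := gap_pos hβ hγ hr0.le hr.2 hY
  rw [(hasDerivAt_logLambda hβ hγ hβγ hr0 hg).deriv, ← mul_neg]
  have : 0 < 1 - β * γ := by linarith
  exact mul_pos (by positivity) (neg_pos.2 (h r hr))

theorem logLambda_lt_of_critSign_pos {X Y : ℝ} (hβ : 0 < β) (hγ : 0 ≤ γ) (hβγ : β * γ < 1)
    (hX : 0 < X) (hXY : X < Y) (hY : γ * Y ^ 2 ≤ β)
    (h : ∀ r ∈ Set.Ioo X Y, 0 < critSign β γ r) : logLambda β γ Y < logLambda β γ X := by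
  refine strictAntiOn_of_deriv_neg (convex_Icc X Y) (continuousOn_logLambda hβ hγ hX) ?_
    ⟨le_rfl, hXY.le⟩ ⟨hXY.le, le_rfl⟩ hXY
  intro r hr
  rw [interior_Icc] at hr
  have hr0 : 0 < r := hX.trans hr.1
  have hg := gap_pos hβ hγ hr0.le hr.2 hY
  rw [(hasDerivAt_logLambda hβ hγ hβγ hr0 hg).deriv, neg_lt_zero]
  have : 0 < 1 - β * γ := by linarith
  exact mul_pos (by positivity) (h r hr)

theorem critDegree_strictAnti {X Y : ℝ} (hβ : 0 < β) (hγ : 0 ≤ γ) (hβγ : β * γ < 1)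
    (hX : 0 < X) (hXY : X < Y) (hY : γ * Y ^ 2 ≤ β) : critDegree β γ Y < critDegree β γ X := by
  have hY0 : 0 < Y := hX.trans hXY
  refine div_lt_div_of_pos_right ?_ (by linarith)
  have h1 : γ * (X * Y) < β := by
    rcases hγ.eq_or_lt with rfl | hγ
    · simpa using hβ
    · have : X * Y < Y ^ 2 := by nlinarith
      exact (mul_lt_mul_of_pos_left this hγ).trans_le hY
  have h2 : (γ * X + β / X) - (γ * Y + β / Y) = (Y - X) * (β - γ * (X * Y)) / (X * Y) := by
    field_simp
    ring
  have h3 : 0 < (Y - X) * (β - γ * (X * Y)) / (X * Y) :=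
    div_pos (mul_pos (by linarith) (by linarith)) (by positivity)
  linarith

theorem sqrt_mul_lt_one (hβγ : β * γ < 1) : Real.sqrt (β * γ) < 1 := by
  rw [Real.sqrt_lt' one_pos]; simpa using hβγ

/-- For `γ > 0`, `x̂_d` is the smaller root of a quadratic whose roots have product `β / γ`. This
allows `X` to replace `d` as parameter of `λ_c`. -/
theorem xHat_spec {d : ℝ} (hβ : 0 < β) (hγ : 0 ≤ γ) (hβγ : β * γ < 1) (hd : IsCritRange β γ d) :
    0 < xHat β γ d ∧ γ * xHat β γ d ^ 2 ≤ β ∧ critDegree β γ (xHat β γ d) = d := by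
  obtain ⟨hd1, hd2⟩ := hd
  rcases hγ.eq_or_lt with rfl | hγ0
  · have h1 : 0 < d - 1 := by linarith
    have h2 : xHat β 0 d = β / (d - 1) := by simp [xHat]
    rw [h2]
    refine ⟨by positivity, by simpa using hβ.le, ?_⟩
    rw [critDegree]
    field_simp
    ring
  · set s := Real.sqrt (β * γ) with hs
    have hβγ0 : 0 < β * γ := by positivity
    have hs0 : 0 < s := Real.sqrt_pos.2 hβγ0
    have hss : s ^ 2 = β * γ := Real.sq_sqrt hβγ0.le
    have hs1 : s < 1 := sqrt_mul_lt_one hβγ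
    set b := -1 - β * γ + d * (1 - β * γ) with hb
    have hb2 : 2 * s ≤ b := by
      have := mul_le_mul_of_nonneg_right hd2 (by linarith : 0 ≤ 1 + s)
      rw [hb, ← hss]
      nlinarith
    have hdisc : 0 ≤ b ^ 2 - 4 * (β * γ) := by
      have := pow_le_pow_left₀ (by positivity) hb2 2
      rw [← hss]; linarith
    have hr2 := Real.sq_sqrt hdisc
    have hr0 := Real.sqrt_nonneg (b ^ 2 - 4 * (β * γ))
    have hXe : 2 * γ * xHat β γ d = b - Real.sqrt (b ^ 2 - 4 * (β * γ)) := by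
      rw [xHat, if_neg hγ0.ne', ← hb]
      field_simp
    set r := Real.sqrt (b ^ 2 - 4 * (β * γ)) with hr
    set X := xHat β γ d with hX
    have hb0 : 0 < b := by linarith
    have hrb : r < b := by
      by_contra! h
      have := pow_le_pow_left₀ hb0.le h 2
      linarith
    have hX0 : 0 < X := by
      have : 0 < 2 * γ * X := by linarith
      exact pos_of_mul_pos_right this (by positivity)
    have hquad : γ * X ^ 2 - b * X + β = 0 := by
      have h1 : (b - 2 * γ * X) ^ 2 = r ^ 2 := by rw [hXe]; ring
      rw [hr2] at h1
      have h2 : 4 * γ * (γ * X ^ 2 - b * X + β) = 0 := by linear_combination h1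
      exact (mul_eq_zero.1 h2).resolve_left (by positivity)
    refine ⟨hX0, ?_, ?_⟩
    · have : 2 * γ * X * X ≤ b * X := mul_le_mul_of_nonneg_right (by linarith) hX0.le
      nlinarith
    · have h1 : 1 - β * γ ≠ 0 := by linarith
      rw [critDegree, div_eq_iff h1]
      field_simp
      linear_combination hquad

theorem lambdaC_pos_and_log {d : ℝ} (hβ : 0 < β) (hγ : 0 ≤ γ) (hβγ : β * γ < 1)
    (hd : IsCritRange β γ d) :
    0 < lambdaC β γ d ∧ Real.log (lambdaC β γ d) = logLambda β γ (xHat β γ d) := by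
  obtain ⟨h1, -, h3⟩ := xHat_spec hβ hγ hβγ hd
  have h4 : 0 < (xHat β γ d + β) / (γ * xHat β γ d + 1) := by positivity
  refine ⟨mul_pos h1 (Real.rpow_pos_of_pos h4 _), ?_⟩
  rw [lambdaC, Real.log_mul h1.ne' (Real.rpow_pos_of_pos h4 _).ne', Real.log_rpow h4, logLambda, h3]

theorem xHat_strictAnti {d₁ d₂ : ℝ} (hβ : 0 < β) (hγ : 0 ≤ γ) (hβγ : β * γ < 1)
    (hd₁ : IsCritRange β γ d₁) (hd₂ : IsCritRange β γ d₂) (h : d₁ < d₂) :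
    xHat β γ d₂ < xHat β γ d₁ := by
  obtain ⟨h1, h2, h3⟩ := xHat_spec hβ hγ hβγ hd₁
  obtain ⟨h4, h5, h6⟩ := xHat_spec hβ hγ hβγ hd₂
  by_contra! hle
  rcases hle.eq_or_lt with he | hlt
  · rw [← h3, ← h6, he] at h
    exact lt_irrefl _ h
  · have := critDegree_strictAnti hβ hγ hβγ h1 hlt h5
    rw [h3, h6] at this
    exact lt_asymm h this

theorem lambdaC_lt_of_critSign_neg {d₁ d₂ : ℝ} (hβ : 0 < β) (hγ : 0 ≤ γ) (hβγ : β * γ < 1)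
    (hd₁ : IsCritRange β γ d₁) (hd₂ : IsCritRange β γ d₂) (h : d₁ < d₂)
    (hs : ∀ r, xHat β γ d₂ < r → 0 < β - γ * r ^ 2 → critSign β γ r < 0) :
    lambdaC β γ d₂ < lambdaC β γ d₁ := by
  obtain ⟨h1, h2, -⟩ := xHat_spec hβ hγ hβγ hd₁
  obtain ⟨h3, -, -⟩ := xHat_spec hβ hγ hβγ hd₂
  obtain ⟨hl1, hl1'⟩ := lambdaC_pos_and_log hβ hγ hβγ hd₁
  obtain ⟨hl2, hl2'⟩ := lambdaC_pos_and_log hβ hγ hβγ hd₂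
  rw [← Real.log_lt_log_iff hl2 hl1, hl1', hl2']
  refine logLambda_lt_of_critSign_neg hβ hγ hβγ h3 (xHat_strictAnti hβ hγ hβγ hd₁ hd₂ h) h2 ?_
  intro r hr
  exact hs r hr.1 (gap_pos hβ hγ (h3.trans hr.1).le hr.2 h2)

theorem lambdaC_lt_of_critSign_pos {d₁ d₂ : ℝ} (hβ : 0 < β) (hγ : 0 ≤ γ) (hβγ : β * γ < 1)
    (hd₁ : IsCritRange β γ d₁) (hd₂ : IsCritRange β γ d₂) (h : d₁ < d₂)
    (hs : ∀ r, 0 < r → r < xHat β γ d₁ → 0 < critSign β γ r) :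
    lambdaC β γ d₁ < lambdaC β γ d₂ := by
  obtain ⟨h1, h2, -⟩ := xHat_spec hβ hγ hβγ hd₁
  obtain ⟨h3, -, -⟩ := xHat_spec hβ hγ hβγ hd₂
  obtain ⟨hl1, hl1'⟩ := lambdaC_pos_and_log hβ hγ hβγ hd₁
  obtain ⟨hl2, hl2'⟩ := lambdaC_pos_and_log hβ hγ hβγ hd₂
  rw [← Real.log_lt_log_iff hl1 hl2, hl1', hl2']
  refine logLambda_lt_of_critSign_pos hβ hγ hβγ h3 (xHat_strictAnti hβ hγ hβγ hd₁ hd₂ h) h2 ?_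
  intro r hr
  exact hs r (h3.trans hr.1) hr.2

theorem critSign_zero (β γ : ℝ) : critSign β γ 0 = Real.log β := by
  simp [critSign]

theorem exists_critSign_eq_zero (hγ : 0 ≤ γ) (hβγ : β * γ < 1) (hβ1 : 1 < β) :
    ∃ X, 0 < X ∧ 0 < β - γ * X ^ 2 ∧ critSign β γ X = 0 := by
  have hβ : 0 < β := by linarith
  have hlogβ : 0 < Real.log β := Real.log_pos hβ1
  have h1βγ : 0 < 1 - β * γ := by linarith
  -- Multiplied by its denominator, `critSign` stays continuous up to `√(β / γ)`, where the
  -- denominator vanishes and `N` is negative.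
  set N : ℝ → ℝ := fun X =>
    (β - γ * X ^ 2) * Real.log ((X + β) / (γ * X + 1)) - 2 * (1 - β * γ) * X with hN
  obtain ⟨Y, hY0, hYβ, hNY⟩ : ∃ Y, 0 < Y ∧ γ * Y ^ 2 ≤ β ∧ N Y < 0 := by
    rcases hγ.eq_or_lt with rfl | hγ0
    -- From `log u ≤ u - 1` one gets `N Y ≤ β log β - Y`, which is `-1` at this point.
    · refine ⟨β * Real.log β + 1, by positivity, by simpa using hβ.le, ?_⟩
      set Y := β * Real.log β + 1 with hY
      have hY0 : 0 < Y := by positivity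
      have h2 : Real.log (Y + β) = Real.log ((Y + β) / β) + Real.log β := by
        rw [Real.log_div (by positivity) hβ.ne']; ring
      have h3 : Real.log ((Y + β) / β) ≤ (Y + β) / β - 1 :=
        Real.log_le_sub_one_of_pos (by positivity)
      have h4 : β * ((Y + β) / β - 1) = Y := by field_simp; ring
      have h5 : β * Real.log (Y + β) ≤ Y + β * Real.log β := by
        rw [h2, mul_add]
        have := mul_le_mul_of_nonneg_left h3 hβ.le
        linarith
      simp only [hN, zero_mul, sub_zero, zero_add, div_one, mul_zero, mul_one]
      linarith
    · have h2 : γ * Real.sqrt (β / γ) ^ 2 = β := by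
        rw [Real.sq_sqrt (by positivity)]; field_simp
      have h3 : 0 < Real.sqrt (β / γ) := Real.sqrt_pos.2 (by positivity)
      refine ⟨Real.sqrt (β / γ), h3, h2.le, ?_⟩
      simp only [hN, h2, sub_self, zero_mul, zero_sub, neg_lt_zero]
      positivity
  have hcont : ContinuousOn N (Set.Icc 0 Y) := by
    intro r hr
    have h1 : ContinuousAt (fun X : ℝ => Real.log ((X + β) / (γ * X + 1))) r :=
      (hasDerivAt_logMessageInv hβ hγ hr.1).continuousAt
    have h2 : ContinuousAt (fun X : ℝ => β - γ * X ^ 2) r := by fun_prop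
    have h3 : ContinuousAt (fun X : ℝ => 2 * (1 - β * γ) * X) r := by fun_prop
    exact ((h2.mul h1).sub h3).continuousWithinAt
  have hN0 : N 0 = β * Real.log β := by simp [hN]
  obtain ⟨X, hX, hNX⟩ := intermediate_value_Icc' hY0.le hcont
    (⟨hNY.le, by rw [hN0]; positivity⟩ : (0 : ℝ) ∈ Set.Icc (N Y) (N 0))
  have hX0 : 0 < X := hX.1.lt_of_ne (by
    rintro rfl
    rw [hN0] at hNX
    have : 0 < β * Real.log β := by positivity
    linarith)
  have hXY : X < Y := hX.2.lt_of_ne (by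
    rintro rfl
    linarith)
  have hg := gap_pos hβ hγ hX0.le hXY hYβ
  refine ⟨X, hX0, hg, ?_⟩
  rw [critSign, sub_eq_zero, eq_div_iff hg.ne']
  have : N X = (β - γ * X ^ 2) * Real.log ((X + β) / (γ * X + 1)) - 2 * (1 - β * γ) * X := rfl
  linarith

theorem isCritRange_of_dBar_lt {d : ℝ} (hβγ : β * γ < 1) (hd : dBar β γ < d) :
    IsCritRange β γ d := by
  have h1 : 0 < 1 - Real.sqrt (β * γ) := by linarith [sqrt_mul_lt_one hβγ]
  have h2 := Real.sqrt_nonneg (β * γ)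
  have h3 : 1 ≤ dBar β γ := by
    rw [dBar, le_div_iff₀ h1]; linarith
  refine ⟨by linarith, ?_⟩
  rw [dBar, div_lt_iff₀ h1] at hd
  exact hd.le

theorem dBar_lt_critDegree {X : ℝ} (hβ : 0 < β) (hγ : 0 ≤ γ) (hβγ : β * γ < 1) (hX : 0 < X)
    (hg : 0 < β - γ * X ^ 2) : dBar β γ < critDegree β γ X := by
  have hβγ0 : 0 ≤ β * γ := by positivity
  set s := Real.sqrt (β * γ) with hs
  have hss : s ^ 2 = β * γ := Real.sq_sqrt hβγ0
  have hs0 : 0 ≤ s := Real.sqrt_nonneg _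
  have hs1 : s < 1 := sqrt_mul_lt_one hβγ
  have h1 : 2 * s * X < γ * X ^ 2 + β := by
    have h2 : (2 * s * X) ^ 2 < (γ * X ^ 2 + β) ^ 2 := by
      have : 0 < (β - γ * X ^ 2) ^ 2 := by positivity
      have e : (2 * s * X) ^ 2 = 4 * (β * γ) * X ^ 2 := by rw [← hss]; ring
      rw [e]; nlinarith
    exact lt_of_pow_lt_pow_left₀ 2 (by positivity) h2
  have h2 : γ * X + β / X = (γ * X ^ 2 + β) / X := by field_simp
  have h3 : 2 * s < (γ * X ^ 2 + β) / X := by rwa [lt_div_iff₀ hX]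
  rw [dBar, critDegree, div_lt_div_iff₀ (by linarith) (by linarith), ← hs, h2, ← hss]
  have : (1 + s) * (1 - s ^ 2) = (2 * s + 1 + s ^ 2) * (1 - s) := by ring
  rw [this]
  exact mul_lt_mul_of_pos_right (by linarith) (by linarith)

theorem IsTurningPoint.le {d e : ℝ} (hd : IsTurningPoint β γ d) (he : IsTurningPoint β γ e) :
    d ≤ e := by
  by_contra! h
  obtain ⟨x, hx1, hx2⟩ := exists_between h
  obtain ⟨y, hy1, hy2⟩ := exists_between hx2
  have h1 : lambdaC β γ y < lambdaC β γ x :=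
    hd.2.1 ⟨he.1.trans hx1, hx2⟩ ⟨he.1.trans (hx1.trans hy1), hy2⟩ hy1
  have h2 : lambdaC β γ x < lambdaC β γ y := he.2.2 hx1 (hx1.trans hy1) hy1
  exact lt_asymm h1 h2

/-- The turning point `d_c` is the degree of the zero of `critSign`. -/
theorem exists_xHat_dCrit (hγ : 0 ≤ γ) (hβγ : β * γ < 1) (hβ1 : 1 < β) :
    IsCritRange β γ (dCrit β γ) ∧
      (∀ r, xHat β γ (dCrit β γ) < r → 0 < β - γ * r ^ 2 → critSign β γ r < 0) ∧
      ∀ r, 0 < r → r < xHat β γ (dCrit β γ) → 0 < critSign β γ r := by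
  have hβ : 0 < β := by linarith
  obtain ⟨X, hX, hg, hX0⟩ := exists_critSign_eq_zero hγ hβγ hβ1
  have hneg : ∀ r, X < r → 0 < β - γ * r ^ 2 → critSign β γ r < 0 := fun r hr hr' =>
    hX0 ▸ critSign_strictAnti hβ hγ hβγ hX.le hr hr'
  have hpos : ∀ r, 0 < r → r < X → 0 < critSign β γ r := fun r hr hr' =>
    hX0 ▸ critSign_strictAnti hβ hγ hβγ hr.le hr' hg
  have hdX := dBar_lt_critDegree hβ hγ hβγ hX hg
  have hrX := isCritRange_of_dBar_lt hβγ hdX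
  have hxX : xHat β γ (critDegree β γ X) = X := by
    obtain ⟨h1, h2, h3⟩ := xHat_spec hβ hγ hβγ hrX
    rcases lt_trichotomy (xHat β γ (critDegree β γ X)) X with h | h | h
    · exact absurd h3 (critDegree_strictAnti hβ hγ hβγ h1 h (by linarith)).ne'
    · exact h
    · exact absurd h3 (critDegree_strictAnti hβ hγ hβγ hX h h2).ne
  have hturn : IsTurningPoint β γ (critDegree β γ X) := by
    refine ⟨hdX, ?_, ?_⟩
    · intro d₁ h1 d₂ h2 h12
      have hr1 := isCritRange_of_dBar_lt hβγ h1.1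
      have hr2 := isCritRange_of_dBar_lt hβγ h2.1
      have := xHat_strictAnti hβ hγ hβγ hr2 hrX h2.2
      rw [hxX] at this
      exact lambdaC_lt_of_critSign_neg hβ hγ hβγ hr1 hr2 h12
        fun r hr hr' => hneg r (this.trans hr) hr'
    · intro d₁ h1 d₂ h2 h12
      have hr1 := isCritRange_of_dBar_lt hβγ (hdX.trans h1)
      have hr2 := isCritRange_of_dBar_lt hβγ (hdX.trans h2)
      have := xHat_strictAnti hβ hγ hβγ hrX hr1 h1
      rw [hxX] at this
      exact lambdaC_lt_of_critSign_pos hβ hγ hβγ hr1 hr2 h12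
        fun r hr hr' => hpos r hr (hr'.trans this)
  have hcrit : IsTurningPoint β γ (dCrit β γ) := Classical.epsilon_spec ⟨_, hturn⟩
  have heq : dCrit β γ = critDegree β γ X := le_antisymm (hcrit.le hturn) (hturn.le hcrit)
  rw [heq, hxX]
  exact ⟨hrX, hneg, hpos⟩

/-- Below the bound for the maximum degree, the activity is below `λ_c` for all smaller degrees. -/
theorem AntiferroPos.lt_lambdaC {x₀ : ℝ} {Δ : ℕ} (hβ : 0 < β) (hγ : 0 ≤ γ) (hβγ : β * γ < 1)
    (h : AntiferroPos β γ x₀ Δ) {d : ℝ} (hd : IsCritRange β γ d) (hdΔ : d ≤ (Δ : ℝ) - 1) :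
    x₀ < lambdaC β γ d := by
  obtain ⟨hΔ, hs, -, h1, h2⟩ := h
  have hΔ' : IsCritRange β γ ((Δ : ℝ) - 1) := by
    refine ⟨hd.1.trans_le hdΔ, hd.2.trans ?_⟩
    exact mul_le_mul_of_nonneg_right hdΔ (by linarith [sqrt_mul_lt_one hβγ])
  have key : ¬ (1 < β ∧ dCrit β γ + 1 < Δ) →
      (∀ r, xHat β γ ((Δ : ℝ) - 1) < r → 0 < β - γ * r ^ 2 → critSign β γ r < 0) →
      x₀ < lambdaC β γ d := by
    intro hc hneg
    have hx : x₀ < lambdaC β γ ((Δ : ℝ) - 1) := by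
      rcases h2 hc with ⟨-, h⟩ | h
      · exact absurd h hΔ'.1.ne'
      · exact h
    rcases hdΔ.eq_or_lt with he | hlt
    · rwa [he]
    · exact hx.trans (lambdaC_lt_of_critSign_neg hβ hγ hβγ hd hΔ' hlt hneg)
  by_cases hβ1 : 1 < β
  · obtain ⟨hc1, hc2, hc3⟩ := exists_xHat_dCrit hγ hβγ hβ1
    -- If `Δ - 1` lies beyond the turning point, the minimum of `λ_c` is at `d_c`; otherwise `λ_c`
    -- decreases up to `Δ - 1`.
    by_cases hc : 1 < β ∧ dCrit β γ + 1 < Δ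
    · refine (h1 hc).trans_le ?_
      rcases lt_trichotomy d (dCrit β γ) with hlt | he | hlt
      · exact (lambdaC_lt_of_critSign_neg hβ hγ hβγ hd hc1 hlt hc2).le
      · rw [he]
      · exact (lambdaC_lt_of_critSign_pos hβ hγ hβγ hc1 hd hlt hc3).le
    · refine key hc fun r hr => hc2 r (lt_of_le_of_lt ?_ hr)
      have hle : (Δ : ℝ) - 1 ≤ dCrit β γ := by
        by_contra! h
        exact hc ⟨hβ1, by linarith⟩
      rcases hle.eq_or_lt with he | hlt
      · rw [he]
      · exact (xHat_strictAnti hβ hγ hβγ hΔ' hc1 hlt).le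
  · refine key (fun h => hβ1 h.1) fun r hr hr' => ?_
    have h0 := (xHat_spec hβ hγ hβγ hΔ').1
    have := critSign_strictAnti hβ hγ hβγ le_rfl (h0.trans hr) hr'
    rw [critSign_zero] at this
    exact this.trans_le (Real.log_nonpos hβ.le (not_lt.1 hβ1))

end

/-! ### Contraction for antiferromagnetic systems -/

section

variable {β γ : ℝ}

/-- Up to a constant factor, the square of the density of messages at the logarithmic message
`y`. -/
noncomputable def messageGap (β γ y : ℝ) : ℝ :=
  1 + β * γ - γ * Real.exp (-y) - β * Real.exp y

theorem exp_tangent_le {a : ℝ} (ha : 0 < a) (y : ℝ) :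
    a * (1 + (y - Real.log a)) ≤ Real.exp y := by
  have h1 : Real.exp y = a * Real.exp (y - Real.log a) := by
    rw [Real.exp_sub, Real.exp_log ha]; field_simp
  rw [h1]
  have := Real.add_one_le_exp (y - Real.log a)
  exact mul_le_mul_of_nonneg_left (by linarith) ha.le

theorem exp_tangent_lt {a : ℝ} (ha : 0 < a) {y : ℝ} (hy : y ≠ Real.log a) :
    a * (1 + (y - Real.log a)) < Real.exp y := by
  have h1 : Real.exp y = a * Real.exp (y - Real.log a) := by
    rw [Real.exp_sub, Real.exp_log ha]; field_simp
  rw [h1]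
  have := Real.add_one_lt_exp (sub_ne_zero.2 hy)
  exact mul_lt_mul_of_pos_left (by linarith) ha

/-- With `v = log x + d y`, division by `exp v` turns the claim into a lower bound for `d² (γ e^{-y}
+ β e^y) + γ e^v + β e^{-v}`, which is convex in `(y, v)`. Its tangent plane at the fixed point
`(log h, log X)` has the required value `(d² - 1) (1 + β γ)` plus `(γ X - β / X) (log x - log
λ_c(d))`, a product of two nonpositive factors. -/
theorem messageGap_mul_lt_of_lt_lambdaC {d x : ℝ} (hβ : 0 < β) (hγ : 0 ≤ γ) (hβγ : β * γ < 1)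
    (hd : IsCritRange β γ d) (hx : 0 < x) (hxd : x < lambdaC β γ d) (y : ℝ) :
    d ^ 2 * messageGap β γ y * (x * Real.exp (d * y)) <
      (γ * (x * Real.exp (d * y)) + 1) * (x * Real.exp (d * y) + β) := by
  obtain ⟨hX0, hXβ, hXd⟩ := xHat_spec hβ hγ hβγ hd
  have hd0 : 0 < d := by linarith [hd.1]
  have hlog := Real.log_lt_log hx hxd
  rw [(lambdaC_pos_and_log hβ hγ hβγ hd).2, logLambda, hXd] at hlog
  set X := xHat β γ d with hX
  have h1 : 0 < 1 - β * γ := by linarith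
  have h2 : 0 < X + β := by linarith
  have h3 : 0 < γ * X + 1 := by positivity
  have hquad : (X + β) * (γ * X + 1) = d * (1 - β * γ) * X := by
    rw [critDegree, div_eq_iff h1.ne'] at hXd
    rw [← hXd]; field_simp; ring
  set v := Real.log x + d * y with hv
  have hf : x * Real.exp (d * y) = Real.exp v := by
    rw [hv, Real.exp_add, Real.exp_log hx]
  set h := (γ * X + 1) / (X + β) with hh
  have hh0 : 0 < h := div_pos h3 h2
  have hloginv : Real.log ((X + β) / (γ * X + 1)) = -Real.log h := by
    rw [← Real.log_inv, hh, inv_div]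
  rw [hloginv] at hlog
  set p := y - Real.log h with hp
  set r := v - Real.log X with hr
  have hrp : r - d * p < 0 := by
    rw [hr, hp, hv]; linarith
  have t1 := exp_tangent_le hh0 y
  have t2 := exp_tangent_le (inv_pos.2 hh0) (-y)
  have t3 := exp_tangent_le hX0 v
  have t4 := exp_tangent_le (inv_pos.2 hX0) (-v)
  have e2 : 1 + (-y - Real.log h⁻¹) = 1 - p := by rw [Real.log_inv, hp]; ring
  have e4 : 1 + (-v - Real.log X⁻¹) = 1 - r := by rw [Real.log_inv, hr]; ring
  rw [e2] at t2
  rw [e4] at t4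
  have hsum : d ^ 2 * (γ * (h⁻¹ * (1 - p)) + β * (h * (1 + p))) +
      (γ * (X * (1 + r)) + β * (X⁻¹ * (1 - r))) <
      d ^ 2 * (γ * Real.exp (-y) + β * Real.exp y) +
        (γ * Real.exp v + β * Real.exp (-v)) := by
    have s2 := mul_le_mul_of_nonneg_left t2 hγ
    have s3 := mul_le_mul_of_nonneg_left t3 hγ
    have s1 := mul_le_mul_of_nonneg_left t1 hβ.le
    have s4 := mul_le_mul_of_nonneg_left t4 hβ.le
    have hd2 : 0 < d ^ 2 := by positivity
    by_cases hp0 : p = 0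
    · have hr0 : -v ≠ Real.log X⁻¹ := by
        rw [Real.log_inv]
        intro h0
        have : r = 0 := by rw [hr]; linarith
        rw [hp0, this] at hrp
        simp at hrp
      have t4' := exp_tangent_lt (inv_pos.2 hX0) hr0
      rw [e4] at t4'
      have s4' := mul_lt_mul_of_pos_left t4' hβ
      have := mul_le_mul_of_nonneg_left (add_le_add s2 s1) hd2.le
      linarith
    · have hp0' : y ≠ Real.log h := fun h0 => hp0 (by rw [hp, h0, sub_self])
      have s1' := mul_lt_mul_of_pos_left (exp_tangent_lt hh0 hp0') hβ
      have := mul_lt_mul_of_pos_left (add_lt_add_of_le_of_lt s2 s1') hd2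
      linarith
  have hgap : γ * X - β / X ≤ 0 := by
    have : γ * X - β / X = (γ * X ^ 2 - β) / X := by field_simp
    rw [this]
    exact div_nonpos_of_nonpos_of_nonneg (by linarith) hX0.le
  -- `i1` matches the slopes in the two variables and `i2` gives the value at the fixed point.
  have i1 : d * (β * h - γ * h⁻¹) = β / X - γ * X := by
    rw [hh, inv_div]
    have a1 : β * ((γ * X + 1) / (X + β)) - γ * ((X + β) / (γ * X + 1)) =
        (1 - β * γ) * (β - γ * X ^ 2) / ((X + β) * (γ * X + 1)) := by field_simp; ring
    rw [a1, hquad]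
    field_simp
  have i2 : d ^ 2 * (γ * h⁻¹ + β * h) + (γ * X + β / X) = (d ^ 2 - 1) * (1 + β * γ) := by
    have a1 : (1 + β * γ) - (γ * h⁻¹ + β * h) =
        (1 - β * γ) ^ 2 * X / ((X + β) * (γ * X + 1)) := by
      rw [hh, inv_div]; field_simp; ring
    have a2 : (1 + β * γ) - (γ * h⁻¹ + β * h) = (1 - β * γ) / d := by
      rw [a1, hquad]; field_simp
    have a3 : γ * X + β / X = d * (1 - β * γ) - (1 + β * γ) := by
      have : γ * X + β / X + (1 + β * γ) = (X + β) * (γ * X + 1) / X := by field_simp; ring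
      rw [hquad] at this
      field_simp at this ⊢
      linarith
    have a4 : γ * h⁻¹ + β * h = 1 + β * γ - (1 - β * γ) / d := by linarith
    rw [a3, a4]
    field_simp
    ring
  have hfin : d ^ 2 * messageGap β γ y < γ * Real.exp v + β * Real.exp (-v) + (1 + β * γ) := by
    rw [messageGap]
    have hnn : 0 ≤ (γ * X - β / X) * (r - d * p) :=
      mul_nonneg_of_nonpos_of_nonpos hgap hrp.le
    have : d ^ 2 * (γ * (h⁻¹ * (1 - p)) + β * (h * (1 + p))) +
      (γ * (X * (1 + r)) + β * (X⁻¹ * (1 - r))) =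
      (d ^ 2 - 1) * (1 + β * γ) + (γ * X - β / X) * (r - d * p) := by
      rw [← i2]
      linear_combination (d * p) * i1
    linarith
  rw [hf]
  have hfin' := mul_lt_mul_of_pos_right hfin (Real.exp_pos v)
  have : Real.exp (-v) * Real.exp v = 1 := by rw [← Real.exp_add]; simp
  calc d ^ 2 * messageGap β γ y * Real.exp v <
      (γ * Real.exp v + β * Real.exp (-v) + (1 + β * γ)) * Real.exp v := hfin'
    _ = (γ * Real.exp v + 1) * (Real.exp v + β) := by linear_combination β * this

theorem messageGap_le (hβ : 0 < β) (hγ : 0 ≤ γ) (y : ℝ) :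
    messageGap β γ y ≤ (1 - Real.sqrt (β * γ)) ^ 2 := by
  have hss : Real.sqrt (β * γ) ^ 2 = β * γ := Real.sq_sqrt (by positivity)
  set s := Real.sqrt (β * γ)
  have h1 : Real.exp (-y) * Real.exp y = 1 := by rw [← Real.exp_add]; simp
  have h2 : 2 * s ≤ γ * Real.exp (-y) + β * Real.exp y := by
    refine le_of_sq_le_sq ?_ (by positivity)
    have e : (γ * Real.exp (-y) + β * Real.exp y) ^ 2 =
        (γ * Real.exp (-y) - β * Real.exp y) ^ 2 + 4 * (β * γ) := by
      linear_combination (4 * β * γ) * h1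
    rw [e, mul_pow, hss]
    nlinarith [sq_nonneg (γ * Real.exp (-y) - β * Real.exp y)]
  rw [messageGap, ← hss]
  linarith

/-- For degrees too small for `x̂_d` to exist, AM–GM on both sides suffices for every ratio `f`. -/
theorem messageGap_mul_lt_of_sqrt {d f : ℝ} (hβ : 0 < β) (hγ : 0 ≤ γ) (hβγ : β * γ < 1)
    (hd : 0 ≤ d) (hds : d * (1 - Real.sqrt (β * γ)) < 1 + Real.sqrt (β * γ)) (hf : 0 ≤ f)
    (y : ℝ) : d ^ 2 * messageGap β γ y * f < (γ * f + 1) * (f + β) := by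
  rcases hf.eq_or_lt with rfl | hf0
  · simpa using hβ
  have hle := messageGap_le hβ hγ y
  have hss : Real.sqrt (β * γ) ^ 2 = β * γ := Real.sq_sqrt (by positivity)
  have hs0 := Real.sqrt_nonneg (β * γ)
  have hs1 := sqrt_mul_lt_one hβγ
  set s := Real.sqrt (β * γ)
  have h1 : d ^ 2 * messageGap β γ y < (1 + s) ^ 2 := by
    calc d ^ 2 * messageGap β γ y ≤ d ^ 2 * (1 - s) ^ 2 :=
          mul_le_mul_of_nonneg_left hle (sq_nonneg d)
      _ = (d * (1 - s)) ^ 2 := by ring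
      _ < _ := pow_lt_pow_left₀ hds (mul_nonneg hd (by linarith)) two_ne_zero
  have h2 : 2 * s * f ≤ γ * f ^ 2 + β := by
    refine le_of_sq_le_sq ?_ (by positivity)
    have e : (2 * s * f) ^ 2 = 4 * (β * γ) * f ^ 2 := by rw [← hss]; ring
    rw [e]
    nlinarith [sq_nonneg (γ * f ^ 2 - β)]
  have h3 := mul_lt_mul_of_pos_right h1 hf0
  have h4 : (γ * f + 1) * (f + β) = γ * f ^ 2 + β + (1 + s ^ 2) * f := by rw [hss]; ring
  rw [h4]
  nlinarith

theorem AntiferroPos.mul_lt_one {x₀ : ℝ} {Δ : ℕ} (h : AntiferroPos β γ x₀ Δ) :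
    β * γ < 1 := by
  have hΔ : (2 : ℝ) ≤ Δ := by exact_mod_cast h.1
  have h1 : Real.sqrt (β * γ) < 1 := h.2.1.trans_lt (by
    rw [div_lt_one (by linarith)]; linarith)
  rw [Real.sqrt_lt' one_pos] at h1
  simpa using h1

theorem AntiferroPos.messageGap_mul_lt {x₀ x : ℝ} {Δ k : ℕ} (hβ : 0 < β) (hγ : 0 ≤ γ)
    (h : AntiferroPos β γ x₀ Δ) (hx : 0 ≤ x) (hxx : x ≤ x₀) (hk : k + 1 ≤ Δ) (y : ℝ) :
    (k : ℝ) ^ 2 * messageGap β γ y * (x * Real.exp (k * y)) <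
      (γ * (x * Real.exp (k * y)) + 1) * (x * Real.exp (k * y) + β) := by
  have hβγ := h.mul_lt_one
  have hf : 0 ≤ x * Real.exp (k * y) := by positivity
  have hs0 := Real.sqrt_nonneg (β * γ)
  by_cases hds : (k : ℝ) * (1 - Real.sqrt (β * γ)) < 1 + Real.sqrt (β * γ)
  · exact messageGap_mul_lt_of_sqrt hβ hγ hβγ (Nat.cast_nonneg k) hds hf y
  rw [not_lt] at hds
  rcases hx.eq_or_lt with rfl | hx0
  · simpa using hβ
  -- Only `γ = 0`, `k = 1` survives here: the case `λ_c(1) = +∞`, checked directly.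
  rcases le_or_gt k 1 with hk1 | hk1
  · have hk1' : (k : ℝ) ≤ 1 := by exact_mod_cast hk1
    have hk0 : (0 : ℝ) ≤ k := Nat.cast_nonneg k
    have hs : Real.sqrt (β * γ) = 0 := by
      have h1 := sqrt_mul_lt_one hβγ
      nlinarith
    rw [hs] at hds
    have hk' : (k : ℝ) = 1 := by linarith
    have hγ0 : γ = 0 := by
      have h1 := (Real.sqrt_eq_zero (by positivity)).1 hs
      exact (mul_eq_zero.1 h1).resolve_left hβ.ne'
    rw [hk', hγ0, messageGap]
    have h1 : 0 < β * Real.exp y := by positivity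
    have h2 : 0 ≤ x * Real.exp (1 * y) := by positivity
    nlinarith
  · have hd : IsCritRange β γ k := ⟨by exact_mod_cast hk1, hds⟩
    have hkΔ : (k : ℝ) ≤ (Δ : ℝ) - 1 := by
      have : (k : ℝ) + 1 ≤ Δ := by exact_mod_cast hk
      linarith
    exact messageGap_mul_lt_of_lt_lambdaC hβ hγ hβγ hd hx0
      (hxx.trans_lt (h.lt_lambdaC hβ hγ hβγ hd hkΔ)) y

theorem messageGap_nonneg {y : ℝ} (h1 : γ ≤ Real.exp y) (h2 : β * Real.exp y ≤ 1) :
    0 ≤ messageGap β γ y := by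
  have h3 : Real.exp (-y) * Real.exp y = 1 := by rw [← Real.exp_add]; simp
  have h4 : γ * Real.exp (-y) ≤ 1 := by
    rw [← h3, mul_comm]
    exact mul_le_mul_of_nonneg_left h1 (Real.exp_pos _).le
  have h5 : messageGap β γ y = (1 - β * Real.exp y) * (1 - γ * Real.exp (-y)) := by
    rw [messageGap]; linear_combination (-β * γ) * h3
  rw [h5]
  exact mul_nonneg (by linarith) (by linarith)

theorem messageGap_logMessage {f : ℝ} (hβ : 0 < β) (hγ : 0 ≤ γ) (hf : 0 ≤ f) :
    messageGap β γ (logMessage β γ f) =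
      (1 - β * γ) ^ 2 * (f / ((γ * f + 1) * (f + β))) := by
  have h1 : 0 < f + β := by linarith
  have h2 : 0 < γ * f + 1 := by positivity
  rw [messageGap, logMessage, Real.exp_neg, Real.exp_log (by positivity), inv_div]
  field_simp
  ring

/-- Jensen for the concave `messageGap`, by its tangent at the mean `t`. -/
theorem sum_messageGap_le (hβ : 0 < β) (hγ : 0 ≤ γ) (m : Multiset ℝ) (t : ℝ)
    (ht : m.sum = m.card * t) : (m.map (messageGap β γ)).sum ≤ m.card * messageGap β γ t := by
  have h : ∀ n : Multiset ℝ, (n.map (messageGap β γ)).sum ≤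
      n.card * messageGap β γ t + (γ * Real.exp (-t) - β * Real.exp t) * (n.sum - n.card * t) := by
    intro n
    induction n using Multiset.induction_on with
    | empty => simp
    | cons a n ih =>
      have h1 := exp_tangent_le (Real.exp_pos t) a
      have h2 := exp_tangent_le (Real.exp_pos (-t)) (-a)
      rw [Real.log_exp] at h1 h2
      have h3 : messageGap β γ a ≤ messageGap β γ t +
          (γ * Real.exp (-t) - β * Real.exp t) * (a - t) := by
        rw [messageGap, messageGap]
        have h4 := mul_le_mul_of_nonneg_left h1 hβ.le
        have h5 := mul_le_mul_of_nonneg_left h2 hγ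
        linarith
      rw [Multiset.map_cons, Multiset.sum_cons, Multiset.card_cons, Multiset.sum_cons]
      push_cast
      linarith
  have := h m
  rwa [ht, sub_self, mul_zero, add_zero] at this

theorem sq_sum_sqrt_le (m : Multiset ℝ) (g : ℝ → ℝ) (hg : ∀ y ∈ m, 0 ≤ g y) :
    (m.map fun y => Real.sqrt (g y)).sum ^ 2 ≤ m.card * (m.map g).sum := by
  induction m using Multiset.induction_on with
  | empty => simp
  | cons a m ih =>
    have ha := hg a (Multiset.mem_cons_self _ _)
    have hm : ∀ y ∈ m, 0 ≤ g y := fun y hy => hg y (Multiset.mem_cons_of_mem hy)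
    have h1 := ih hm
    have h2 := Real.sq_sqrt ha
    have h3 := Real.sqrt_nonneg (g a)
    have h4 : 0 ≤ (m.map g).sum := Multiset.sum_nonneg (by simpa using hm)
    have h5 : 0 ≤ (m.map fun y => Real.sqrt (g y)).sum :=
      Multiset.sum_nonneg (by
        intro b hb
        obtain ⟨y, _, rfl⟩ := Multiset.mem_map.1 hb
        exact Real.sqrt_nonneg _)
    have hk : (0 : ℝ) ≤ m.card := Nat.cast_nonneg _
    simp only [Multiset.map_cons, Multiset.sum_cons, Multiset.card_cons]
    push_cast
    set u := Real.sqrt (g a)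
    set S := (m.map fun y => Real.sqrt (g y)).sum
    set Q := (m.map g).sum
    set k : ℝ := (m.card : ℝ)
    rw [← h2]
    have h6 : 2 * (u * S) ≤ k * u ^ 2 + Q := by
      refine le_of_sq_le_sq ?_ (by positivity)
      have : (u * S) ^ 2 ≤ u ^ 2 * (k * Q) := by
        rw [mul_pow]; exact mul_le_mul_of_nonneg_left h1 (sq_nonneg u)
      nlinarith [sq_nonneg (k * u ^ 2 - Q)]
    nlinarith

/-- The ratio on the symmetric tree stays uniformly inside the contraction region. -/
theorem AntiferroPos.exists_bound {x₀ x a b : ℝ} {Δ : ℕ} (hβ : 0 < β) (hγ : 0 ≤ γ)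
    (h : AntiferroPos β γ x₀ Δ) (hx : 0 ≤ x) (hxx : x ≤ x₀) :
    ∃ ρ < 1, ∀ k : ℕ, k + 1 ≤ Δ → ∀ y ∈ Set.Icc a b,
      (k : ℝ) ^ 2 * messageGap β γ y * (x * Real.exp (k * y) /
        ((γ * (x * Real.exp (k * y)) + 1) * (x * Real.exp (k * y) + β))) ≤ ρ := by
  have key : ∀ᶠ ρ : ℝ in nhdsWithin 1 (Set.Iio 1), ∀ k ∈ Finset.range Δ, ∀ y ∈ Set.Icc a b,
      (k : ℝ) ^ 2 * messageGap β γ y * (x * Real.exp (k * y) /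
        ((γ * (x * Real.exp (k * y)) + 1) * (x * Real.exp (k * y) + β))) ≤ ρ := by
    rw [Filter.eventually_all_finset]
    intro k hk
    rw [Finset.mem_range] at hk
    have hden : ∀ y : ℝ, 0 < (γ * (x * Real.exp (k * y)) + 1) * (x * Real.exp (k * y) + β) :=
      fun y => by positivity
    rcases (Set.Icc a b).eq_empty_or_nonempty with he | hne
    · simp [he]
    obtain ⟨y₀, -, hmax⟩ := isCompact_Icc.exists_isMaxOn hne (f := fun y : ℝ =>
      (k : ℝ) ^ 2 * messageGap β γ y * (x * Real.exp (k * y) /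
        ((γ * (x * Real.exp (k * y)) + 1) * (x * Real.exp (k * y) + β)))) (by
      have hc : Continuous (messageGap β γ) := by unfold messageGap; fun_prop
      refine Continuous.continuousOn ((continuous_const.mul hc).mul (Continuous.div ?_ ?_ ?_))
      · fun_prop
      · fun_prop
      · exact fun y => (hden y).ne')
    have hlt : (k : ℝ) ^ 2 * messageGap β γ y₀ * (x * Real.exp (k * y₀) /
        ((γ * (x * Real.exp (k * y₀)) + 1) * (x * Real.exp (k * y₀) + β))) < 1 := by
      rw [← mul_div_assoc, div_lt_one (hden y₀)]
      exact h.messageGap_mul_lt hβ hγ hx hxx hk y₀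
    filter_upwards [Ioo_mem_nhdsLT hlt] with ρ hρ y hy
    exact (hmax hy).trans hρ.1.le
  have hlt : ∀ᶠ ρ : ℝ in nhdsWithin 1 (Set.Iio 1), ρ < 1 := self_mem_nhdsWithin
  obtain ⟨ρ, hρ1, hρ2⟩ := (hlt.and key).exists
  exact ⟨ρ, hρ1, fun k hk => hρ2 k (Finset.mem_range.2 hk)⟩

/-- An interval of logarithmic messages that is invariant under the tree recursion. -/
theorem exists_message_interval {x : ℝ} (Δ : ℕ) (hβ : 0 < β) (hγ : 0 ≤ γ) (hβγ : β * γ < 1)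
    (hx : 0 ≤ x) : ∃ a ≤ -Real.log β, (γ ≠ 0 → Real.log γ ∈ Set.Icc a (-Real.log β)) ∧
      γ ≤ Real.exp a ∧ ∀ m : Multiset ℝ, (∀ y ∈ m, y ∈ Set.Icc a (-Real.log β)) → m.card ≤ Δ →
        logMessage β γ (x * Real.exp m.sum) ∈ Set.Icc a (-Real.log β) := by
  have hup : ∀ f : ℝ, 0 ≤ f → logMessage β γ f ≤ -Real.log β := by
    intro f hf
    rw [← Real.log_inv, logMessage]
    refine Real.log_le_log (by positivity) ?_
    rw [div_le_iff₀ (by positivity), inv_mul_eq_div, le_div_iff₀ hβ]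
    nlinarith
  rcases hγ.eq_or_lt with rfl | hγ0
  · set F := x * Real.exp (Δ * |Real.log β|) with hF
    have hF0 : 0 ≤ F := by positivity
    refine ⟨-Real.log (F + β), ?_, fun h => absurd rfl h, (Real.exp_pos _).le, ?_⟩
    · exact neg_le_neg (Real.log_le_log hβ (by linarith))
    · intro m hm hcard
      have hf0 : 0 ≤ x * Real.exp m.sum := by positivity
      refine ⟨?_, hup _ hf0⟩
      have hsum : m.sum ≤ Δ * |Real.log β| := by
        have h1 : m.sum ≤ m.card • |Real.log β| :=
          Multiset.sum_le_card_nsmul _ _ fun y hy => (hm y hy).2.trans (neg_le_abs _)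
        rw [nsmul_eq_mul] at h1
        exact h1.trans (mul_le_mul_of_nonneg_right (by exact_mod_cast hcard) (abs_nonneg _))
      have hfF : x * Real.exp m.sum ≤ F :=
        mul_le_mul_of_nonneg_left (Real.exp_le_exp.2 hsum) hx
      rw [logMessage, zero_mul, zero_add, one_div, Real.log_inv]
      exact neg_le_neg (Real.log_le_log (by linarith) (by linarith))
  · have hle : Real.log γ ≤ -Real.log β := by
      have := Real.log_nonpos (by positivity) hβγ.le
      rw [Real.log_mul hβ.ne' hγ0.ne'] at this
      linarith
    refine ⟨Real.log γ, hle, fun _ => ⟨le_rfl, hle⟩, (Real.exp_log hγ0).ge, ?_⟩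
    intro m _ _
    have hf0 : 0 ≤ x * Real.exp m.sum := by positivity
    refine ⟨Real.log_le_log hγ0 ?_, hup _ hf0⟩
    rw [le_div_iff₀ (by positivity)]
    nlinarith

/-- With `G = f / ((γ f + 1) (f + β))` the slope is `(1 - β γ) G` and `messageGap` at the output is
`(1 - β γ)² G`. Contraction thus amounts to `(∑ w)² G < 1`, where Cauchy–Schwarz and Jensen replace
all children by their mean. -/
theorem realContraction_of_antiferroPos {x₀ x : ℝ} {Δ : ℕ} (hβ : 0 < β) (hγ : 0 ≤ γ)
    (h : AntiferroPos β γ x₀ Δ) (hx : 0 ≤ x) (hxx : x ≤ x₀) :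
    ∃ (I : Set ℝ) (w : ℝ → ℝ) (η w₀ w₁ L : ℝ), 0 < η ∧ η ≤ 1 ∧ 0 < w₀ ∧
      RealContraction β γ x Δ I w η w₀ w₁ L := by
  have hβγ := h.mul_lt_one
  have hβγ1 : 0 < 1 - β * γ := by linarith
  have hΔ : (2 : ℝ) ≤ Δ := by exact_mod_cast h.1
  obtain ⟨a, hab, haγ, hexpa, hinv⟩ := exists_message_interval Δ hβ hγ hβγ hx
  obtain ⟨ρ, hρ1, hρ⟩ := h.exists_bound (a := a) (b := -Real.log β) hβ hγ hx hxx
  set η := min ((1 - ρ) / 3) (1 / 2) with hη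
  have hη0 : 0 < η := lt_min (by linarith) (by norm_num)
  have hη1 : η ≤ 1 / 2 := min_le_right _ _
  have hηρ : ρ ≤ 1 - 3 * η := by
    have := min_le_left ((1 - ρ) / 3) (1 / 2 : ℝ)
    rw [← hη] at this
    linarith
  -- `messageGap` vanishes at the ends of the range, so `ε` keeps the weight positive; it costs at
  -- most `η`, and `ρ + η ≤ 1 - 2 η ≤ (1 - η) ^ 2`.
  set ε := η / (Δ : ℝ) ^ 2 with hε
  have hε0 : 0 < ε := by positivity
  have hgap : ∀ y ∈ Set.Icc a (-Real.log β), 0 ≤ messageGap β γ y := by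
    intro y hy
    refine messageGap_nonneg (hexpa.trans (Real.exp_le_exp.2 hy.1)) ?_
    have := Real.exp_le_exp.2 hy.2
    rw [Real.exp_neg, Real.exp_log hβ] at this
    calc β * Real.exp y ≤ β * β⁻¹ := mul_le_mul_of_nonneg_left this hβ.le
      _ = 1 := mul_inv_cancel₀ hβ.ne'
  refine ⟨Set.Icc a (-Real.log β), fun y => Real.sqrt (messageGap β γ y + ε), η, Real.sqrt ε,
    Real.sqrt (1 + β * γ + ε), |a| + |Real.log β|, hη0, by linarith, Real.sqrt_pos.2 hε0,
    ?_, ?_, ?_, ⟨hab, le_rfl⟩, haγ, fun m hm hc => hinv m hm (by omega), ?_⟩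
  · intro y hy
    have h1 := neg_abs_le a
    have h2 := neg_le_abs (Real.log β)
    rw [abs_le]
    constructor <;> linarith [hy.1, hy.2, abs_nonneg a, abs_nonneg (Real.log β)]
  · intro y hy
    exact Real.sqrt_le_sqrt (by linarith [hgap y hy])
  · intro y hy
    refine Real.sqrt_le_sqrt ?_
    have h1 : 0 < β * Real.exp y := by positivity
    have h2 : 0 ≤ γ * Real.exp (-y) := by positivity
    rw [messageGap]; linarith
  · intro m hm hcard
    set f := x * Real.exp m.sum with hf
    have hf0 : 0 ≤ f := by positivity
    have hden : 0 < (γ * f + 1) * (f + β) := by positivity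
    set G := f / ((γ * f + 1) * (f + β)) with hG
    have hG0 : 0 ≤ G := by positivity
    have hG1 : G ≤ 1 := by
      rw [hG, div_le_one hden]
      nlinarith [mul_nonneg hγ hf0, mul_nonneg (mul_nonneg hγ hf0) hf0,
        mul_nonneg (mul_nonneg hγ hf0) hβ.le]
    have hslope : messageSlope β γ f = (1 - β * γ) * G := by
      rw [messageSlope, hG, abs_sub_comm, abs_of_pos hβγ1, mul_div_assoc]
    rw [hslope]
    simp only [messageGap_logMessage hβ hγ hf0]
    rw [← hG]
    set W := (m.map fun y => Real.sqrt (messageGap β γ y + ε)).sum with hW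
    rcases Nat.eq_zero_or_pos m.card with hk0 | hk0
    · have : m = 0 := Multiset.card_eq_zero.1 hk0
      have hW0 : W = 0 := by rw [hW, this]; simp
      rw [hW0, zero_mul]
      exact mul_nonneg (by linarith) (Real.sqrt_nonneg _)
    have hk : (0 : ℝ) < m.card := by exact_mod_cast hk0
    have hkΔ : (m.card : ℝ) ≤ Δ := by exact_mod_cast (by omega : m.card ≤ Δ)
    set t := m.sum / m.card with ht
    have hsum : m.sum = m.card * t := by rw [ht]; field_simp
    have htI : t ∈ Set.Icc a (-Real.log β) := by
      constructor
      · rw [ht, le_div_iff₀ hk, mul_comm, ← nsmul_eq_mul]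
        exact Multiset.card_nsmul_le_sum fun y hy => (hm y hy).1
      · rw [ht, div_le_iff₀ hk, mul_comm, ← nsmul_eq_mul]
        exact Multiset.sum_le_card_nsmul _ _ fun y hy => (hm y hy).2
    have hb := hρ m.card hcard t htI
    rw [← hsum, ← hf, ← hG] at hb
    have hW2 : W ^ 2 ≤ (m.card : ℝ) ^ 2 * (messageGap β γ t + ε) := by
      have h1 := sq_sum_sqrt_le m (fun y => messageGap β γ y + ε)
        fun y hy => by linarith [hgap y (hm y hy)]
      have h2 : (m.map fun y => messageGap β γ y + ε).sum =
          (m.map (messageGap β γ)).sum + m.card * ε := by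
        rw [Multiset.sum_map_add]; simp
      have h3 := sum_messageGap_le hβ hγ m t hsum
      rw [h2] at h1
      refine h1.trans ?_
      have := mul_le_mul_of_nonneg_left (add_le_add_left h3 (m.card * ε)) hk.le
      refine this.trans (le_of_eq ?_)
      ring
    have hWG : W ^ 2 * G ≤ (1 - η) ^ 2 := by
      have h1 := mul_le_mul_of_nonneg_right hW2 hG0
      have h2 : (m.card : ℝ) ^ 2 * ε * G ≤ η := by
        have h3 : (m.card : ℝ) ^ 2 * ε ≤ (Δ : ℝ) ^ 2 * ε := by gcongr
        have h4 : (Δ : ℝ) ^ 2 * ε = η := by rw [hε]; field_simp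
        calc (m.card : ℝ) ^ 2 * ε * G ≤ (m.card : ℝ) ^ 2 * ε * 1 := by gcongr
          _ ≤ η := by linarith
      nlinarith
    have hW0 : 0 ≤ W := by
      refine Multiset.sum_nonneg ?_
      intro b hb
      obtain ⟨y, _, rfl⟩ := Multiset.mem_map.1 hb
      exact Real.sqrt_nonneg _
    refine le_of_sq_le_sq ?_ (mul_nonneg (by linarith) (Real.sqrt_nonneg _))
    have hQ : 0 ≤ (1 - β * γ) ^ 2 * G := by positivity
    rw [mul_pow (1 - η), Real.sq_sqrt (by linarith)]
    calc (W * ((1 - β * γ) * G)) ^ 2 = (W ^ 2 * G) * ((1 - β * γ) ^ 2 * G) := by ring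
      _ ≤ (1 - η) ^ 2 * ((1 - β * γ) ^ 2 * G) := mul_le_mul_of_nonneg_right hWG hQ
      _ ≤ _ := mul_le_mul_of_nonneg_left (by linarith) (sq_nonneg _)

/-! ### Compactness of the segment and conclusion -/

/-- Near every point of the segment there is an invariant set of messages. -/
theorem eventually_exists_messageInvariant {x₀ x : ℝ} {Δ : ℕ} (hβ : 0 < β) (hγ : 0 ≤ γ)
    (h : FerroPos β γ x₀ Δ ∨ FerroNeg β γ x₀ Δ ∨ AntiferroPos β γ x₀ Δ ∨ AntiferroNeg β γ x₀ Δ)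
    (hx : x ∈ Set.uIcc 0 x₀) :
    ∀ᶠ z : ℂ in nhds (x : ℂ), ∃ U, MessageInvariant β γ z Δ U := by
  have hnear : ∀ ρ, |x₀| < ρ → ∀ᶠ z : ℂ in nhds (x : ℂ), ‖z‖ < ρ := by
    intro ρ hρ
    have h1 : ‖(x : ℂ)‖ < ρ := by
      rw [Complex.norm_real]
      refine lt_of_le_of_lt ?_ hρ
      simpa using Set.abs_sub_left_of_mem_uIcc hx
    exact continuous_norm.continuousAt.eventually_lt_const h1
  rcases h with h | h | h | h
  · rw [Set.uIcc_of_le h.2.1.le] at hx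
    obtain ⟨I, w, η, w₀, w₁, L, h1, h2, h3, h4⟩ :=
      realContraction_of_ferroPos hβ hγ h hx.1 hx.2
    exact h4.eventually_messageInvariant hβ hγ hx.1 h1 h2 h3
  · obtain ⟨h1, h2, h3⟩ := h
    filter_upwards [hnear _ (by rw [abs_of_neg h2]; exact neg_lt.1 h3)] with z hz
    exact ⟨_, messageInvariant_of_ferroNeg hβ hγ h1 hz⟩
  · rw [Set.uIcc_of_le h.2.2.1.le] at hx
    obtain ⟨I, w, η, w₀, w₁, L, h1, h2, h3, h4⟩ :=
      realContraction_of_antiferroPos hβ hγ h hx.1 hx.2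
    exact h4.eventually_messageInvariant hβ hγ hx.1 h1 h2 h3
  · obtain ⟨ρ, h1, h2⟩ := exists_messageInvariant_of_antiferroNeg hβ hγ h
    filter_upwards [hnear ρ h1] with z hz
    exact h2 z hz

end

end TwoSpin

theorem theorem1 (β γ x₀ : ℝ) (Δ : ℕ) (hβ : 0 < β) (hγ : 0 ≤ γ)
    (h : TwoSpin.FerroPos β γ x₀ Δ ∨ TwoSpin.FerroNeg β γ x₀ Δ ∨
      TwoSpin.AntiferroPos β γ x₀ Δ ∨ TwoSpin.AntiferroNeg β γ x₀ Δ) :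
    ∃ δ : ℝ, 0 < δ ∧
      ∀ (V : Type*) [Fintype V] [DecidableEq V] (G : SimpleGraph V) [DecidableRel G.Adj],
        (∀ v, G.degree v ≤ Δ) →
        ∀ (S : Finset V) (τ : S → Fin 2), TwoSpin.Feasible β γ G S τ →
          ∀ z ∈ Metric.thickening δ (Complex.ofReal '' Set.uIcc 0 x₀), z ≠ 0 →
            TwoSpin.partitionFunction (β : ℂ) (γ : ℂ) G S τ z ≠ 0 := by
  have hcomp : IsCompact (Complex.ofReal '' Set.uIcc 0 x₀) :=
    isCompact_uIcc.image Complex.continuous_ofReal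
  -- The activities with an invariant set form a neighbourhood of each point of the compact segment,
  -- so one `δ` serves all graphs and pinnings.
  obtain ⟨δ, hδ, hsub⟩ := hcomp.exists_thickening_subset_open
    (isOpen_interior (s := {z : ℂ | ∃ U, TwoSpin.MessageInvariant (β : ℂ) γ z Δ U})) (by
      rintro _ ⟨x, hx, rfl⟩
      exact mem_interior_iff_mem_nhds.2 (TwoSpin.eventually_exists_messageInvariant hβ hγ h hx))
  refine ⟨δ, hδ, fun V _ _ G _ hG S τ hτ z hz hz0 => ?_⟩
  obtain ⟨U, hU⟩ := interior_subset (hsub hz)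
  exact hU.partitionFunction_ne_zero hβ.ne' hz0 hG hτ
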